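/- **Theorem 2.5.** Let $p,q>0$. For $s>0$ put $$A_s(z)=z+b(s)+\frac{c(s)}{z}+\frac{d(s)}{z^{2}},$$ $$b(s)=3s^2+4sp+2sq+p^2+pq,\quad c(s)=s(s+p)(s+p+q)(3s+2p+q),\quad d(s)=s^2(s+p)^2(s+p+q)^2,$$ and let $z_1(x,s),z_2(x,s),z_3(x,s)$ be the solutions, with multiplicity, of $A_s(z)=x$, $x\in\mathbb C$, labelled so that $|z_1(x,s)|\ge|z_2(x,s)|\ge|z_3(x,s)|$ (ties broken arbitrarily). For $j=1,2$ let $$\Gamma_j(s)=\{x\in\mathbb C : |z_j(x,s)|=|z_{j+1}(x,s)|\}\subset\mathbb R ,$$ let $z_{j+}(x,s)$ and $z_{j-}(x,s)$ be the limits of $z_j(\tilde x,s)$ as $\tilde x\to x\in\mathbb R$ from the upper and from the lower half plane, and define $z_{j\pm}'$ likewise from the derivative $z_j'$ of $z_j$ with respect to $x$. Let $\mu_j^s$ be the measure on $\Gamma_j(s)$ with $$d\mu_j^s(x)=\frac1{2\pi i}\left(\frac{z_{j-}'(x,s)}{z_{j-}(x,s)}-\frac{z_{j+}'(x,s)}{z_{j+}(x,s)}\right)dx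 ,$$ and put $$\nu_j^\xi=\frac1\xi\int_0^\xi\mu_j^s\,ds\quad(\xi>0),\qquad V_j(x)=\int_0^\infty\log\left|\frac{z_j(x,s)}{z_{j+1}(x,s)}\right|ds .$$ The integrals defining $V_1(x)$ for $x>0$ and $V_2(x)$ for $x<0$ converge absolutely. For every $x>0$, $$V_1(x)=\sqrt{q^2+4x}-p\log(4x)-q\log\left(\sqrt{q^2+4x}+q\right)-2p-q+p\log(4p^2+4pq)+q\log(2p+2q),$$ and $$V_2(x)=\begin{cases}0, & x<-q^2/4,\\[1mm] -2\sqrt{q^2+4x}+q\log\left(\dfrac{q+\sqrt{q^2+4x}}{q-\sqrt{q^2+4x}}\right), & -q^2/4\le x<0.\end{cases}$$ For every $\xi>0$ the measures $\nu_1^\xi$ and $\nu_2^\xi$ are well defined (the maps $s\mapsto\mu_j^s$ are measurable on $(0,\xi]$ up to null sets) and have densities with respect to Lebesgue measure on $\mathbb R$, vanishing off their supports. One has $0\notin\operatorname{supp}(\nu_1^\xi)$ and $\operatorname{supp}(\nu_2^\xi)\subset(-\infty,0)$; the boundary values $z_{j\pm}(x,\xi)$ exist for all $x\in\operatorname{supp}(\nu_j^\xi)$,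 and with $$c=\frac{\xi(\xi+p)(\xi+p+q)}{2\pi i}$$ the densities are $$\frac{d\nu_1^\xi}{dx}(x)=\frac{1}{\xi}\,c\,\frac{z_{1+}(x,\xi)-z_{1-}(x,\xi)}{z_{1+}(x,\xi)\,z_{1-}(x,\xi)\,x},\qquad x\in\operatorname{supp}(\nu_1^\xi),$$ $$\frac{d\nu_2^\xi}{dx}(x)=\begin{cases}\dfrac1\xi\, c\,\dfrac{z_{2+}(x,\xi)-z_{2-}(x,\xi)}{z_{2+}(x,\xi)\,z_{2-}(x,\xi)\,x}, & x\in\operatorname{supp}(\nu_2^\xi),\ -q^2/4<x<0,\\[4mm] \dfrac1\xi\left(c\,\dfrac{z_{2+}(x,\xi)-z_{2-}(x,\xi)}{z_{2+}(x,\xi)\,z_{2-}(x,\xi)\,x}+\dfrac{\sqrt{|q^2+4x|}}{2\pi x}\right), & x\in\operatorname{supp}(\nu_2^\xi),\ x\le-q^2/4.\end{cases}$$ -/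

import Mathlib

open Filter Topology MeasureTheory Set

noncomputable section

namespace Macdonald

/-- The limiting recurrence coefficient `b(s)`. -/
def coeffB (p q s : ℝ) : ℝ := 3 * s ^ 2 + 4 * s * p + 2 * s * q + p ^ 2 + p * q

/-- The limiting recurrence coefficient `c(s)`. -/
def coeffC (p q s : ℝ) : ℝ := s * (s + p) * (s + p + q) * (3 * s + 2 * p + q)

/-- The limiting recurrence coefficient `d(s)`. -/
def coeffD (p q s : ℝ) : ℝ := s ^ 2 * (s + p) ^ 2 * (s + p + q) ^ 2

/-- The symbol `A_s(z) = z + b(s) + c(s) z⁻¹ + d(s) z⁻²` (meaningful for `z ≠ 0`). -/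
def symbol (p q s : ℝ) (z : ℂ) : ℂ :=
  z + (coeffB p q s : ℂ) + (coeffC p q s : ℂ) / z + (coeffD p q s : ℂ) / z ^ 2

/-- `z 0, z 1, z 2` are the solutions of `A_s(z) = x`, listed with multiplicity and labelled so
that `|z 0| ≥ |z 1| ≥ |z 2|`. -/
def IsOrderedSolutions (p q s : ℝ) (x : ℂ) (z : Fin 3 → ℂ) : Prop :=
  (∀ w : ℂ, w ≠ 0 → w ^ 2 * (symbol p q s w - x) = (w - z 0) * (w - z 1) * (w - z 2)) ∧
    ‖z 1‖ ≤ ‖z 0‖ ∧ ‖z 2‖ ≤ ‖z 1‖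

theorem exists_isOrderedSolutions (p q s : ℝ) (x : ℂ) :
    ∃ z : Fin 3 → ℂ, IsOrderedSolutions p q s x z := by
  classical
  let C : Cubic ℂ := ⟨1, (coeffB p q s : ℂ) - x, (coeffC p q s : ℂ), (coeffD p q s : ℂ)⟩
  have ha : C.a ≠ 0 := one_ne_zero
  have hs : (C.toPoly.map (RingHom.id ℂ)).Splits := IsAlgClosed.splits _
  obtain ⟨u, v, t, huvt⟩ := (Cubic.splits_iff_roots_eq_three (φ := RingHom.id ℂ) ha).1 hs
  have hP := Cubic.eq_prod_three_roots (φ := RingHom.id ℂ) ha huvt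
  have key : ∀ w : ℂ, w ≠ 0 →
      w ^ 2 * (symbol p q s w - x) = (w - u) * (w - v) * (w - t) := by
    intro w hw
    have h := congrArg (Polynomial.eval w) hP
    simp [Cubic.map, Cubic.toPoly, C] at h
    rw [← h, symbol]
    field_simp
    ring
  have fin : ∀ a b c : ℂ, (∀ w : ℂ, w ≠ 0 →
      w ^ 2 * (symbol p q s w - x) = (w - a) * (w - b) * (w - c)) → ‖b‖ ≤ ‖a‖ → ‖c‖ ≤ ‖b‖ →
      ∃ z : Fin 3 → ℂ, IsOrderedSolutions p q s x z := by
    intro a b c h h1 h2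
    exact ⟨![a, b, c], by simpa using h, by simpa using h1, by simpa using h2⟩
  rcases le_total ‖u‖ ‖v‖ with h1 | h1 <;> rcases le_total ‖v‖ ‖t‖ with h2 | h2 <;>
    rcases le_total ‖u‖ ‖t‖ with h3 | h3
  · exact fin t v u (fun w hw => by rw [key w hw]; ring) h2 h1
  · exact fin t v u (fun w hw => by rw [key w hw]; ring) h2 h1
  · exact fin v t u (fun w hw => by rw [key w hw]; ring) h2 h3
  · exact fin v u t (fun w hw => by rw [key w hw]; ring) h1 h3
  · exact fin t u v (fun w hw => by rw [key w hw]; ring) h3 h1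
  · exact fin u t v (fun w hw => by rw [key w hw]; ring) h3 h2
  · exact fin u v t (fun w hw => by rw [key w hw]) h1 h2
  · exact fin u v t (fun w hw => by rw [key w hw]) h1 h2

/-- `sol p q s x 0`, `sol p q s x 1`, `sol p q s x 2` are the solutions `z₁(x,s)`, `z₂(x,s)`,
`z₃(x,s)` of `A_s(z) = x`, with `|z₁| ≥ |z₂| ≥ |z₃|`; a tie between absolute values is broken
arbitrarily. -/
def sol (p q s : ℝ) (x : ℂ) : Fin 3 → ℂ := Classical.choose (exists_isOrderedSolutions p q s x)

theorem sol_spec (p q s : ℝ) (x : ℂ) : IsOrderedSolutions p q s x (sol p q s x) :=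
  Classical.choose_spec (exists_isOrderedSolutions p q s x)

/-- `Γ₁(s)` (for `j = 0`) and `Γ₂(s)` (for `j = 1`): the set where `|z_j| = |z_{j+1}|`. -/
def Gam (p q s : ℝ) (j : Fin 2) : Set ℂ :=
  {x | ‖sol p q s x j.castSucc‖ = ‖sol p q s x j.succ‖}

/-- The limit from the `+` side, the upper half plane (the left of the real line, which is oriented
from left to right). -/
def upperNhds (x : ℝ) : Filter ℂ := 𝓝[{w : ℂ | 0 < w.im}] (x : ℂ)

/-- The limit from the `-` side, the lower half plane. -/
def lowerNhds (x : ℝ) : Filter ℂ := 𝓝[{w : ℂ | w.im < 0}] (x : ℂ)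

/-- The boundary value `z_{j+}(x,s)`. -/
def solPlus (p q s : ℝ) (j : Fin 3) (x : ℝ) : ℂ := limUnder (upperNhds x) fun w => sol p q s w j

/-- The boundary value `z_{j-}(x,s)`. -/
def solMinus (p q s : ℝ) (j : Fin 3) (x : ℝ) : ℂ := limUnder (lowerNhds x) fun w => sol p q s w j

/-- The boundary value `z'_{j+}(x,s)` of the derivative of `z_j` with respect to `x`. -/
def derivSolPlus (p q s : ℝ) (j : Fin 3) (x : ℝ) : ℂ :=
  limUnder (upperNhds x) (deriv fun w => sol p q s w j)

/-- The boundary value `z'_{j-}(x,s)` of the derivative of `z_j` with respect to `x`. -/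
def derivSolMinus (p q s : ℝ) (j : Fin 3) (x : ℝ) : ℂ :=
  limUnder (lowerNhds x) (deriv fun w => sol p q s w j)

/-- The expression `(2πi)⁻¹ (z'_{j-} / z_{j-} - z'_{j+} / z_{j+})`. -/
def muDensity (p q s : ℝ) (j : Fin 2) (x : ℝ) : ℂ :=
  1 / (2 * Real.pi * Complex.I) *
    (derivSolMinus p q s j.castSucc x / solMinus p q s j.castSucc x -
      derivSolPlus p q s j.castSucc x / solPlus p q s j.castSucc x)

/-- The measures `μ₁ˢ` (for `j = 0`) and `μ₂ˢ` (for `j = 1`), carried by `Γ_j(s)`, which is a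
subset of the real line; there `muDensity` is real and non-negative. -/
def mu (p q : ℝ) (j : Fin 2) (s : ℝ) : Measure ℝ :=
  (volume.restrict {x : ℝ | (x : ℂ) ∈ Gam p q s j}).withDensity
    fun x => ENNReal.ofReal (muDensity p q s j x).re

/-- The measures `ν_j^ξ = (1 / ξ) ∫_0^ξ μ_jˢ ds`. -/
def nu (p q ξ : ℝ) (j : Fin 2) : Measure ℝ :=
  ENNReal.ofReal (1 / ξ) • Measure.bind (volume.restrict (Ioc 0 ξ)) (mu p q j)

/-- The integrand `s ↦ log |z_j(x,s) / z_{j+1}(x,s)|` of the external fields. -/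
def logRatio (p q : ℝ) (j : Fin 2) (x s : ℝ) : ℝ :=
  Real.log ‖sol p q s (x : ℂ) j.castSucc / sol p q s (x : ℂ) j.succ‖

/-- The external fields `V₁` (for `j = 0`) and `V₂` (for `j = 1`). -/
def extField (p q : ℝ) (j : Fin 2) (x : ℝ) : ℝ := ∫ s in Ioi (0 : ℝ), logRatio p q j x s

/-- `f` is a density of `m` with respect to Lebesgue measure, vanishing off the support of `m`. -/
def IsDensity (m : Measure ℝ) (f : ℝ → ℝ) : Prop :=
  Measurable f ∧ (∀ x, 0 ≤ f x) ∧ m = volume.withDensity (fun x => ENNReal.ofReal (f x)) ∧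
    ∀ x, x ∉ m.support → f x = 0

/-- Both boundary values of `z_j(·, s)` at the real point `x` exist. -/
def HasBoundaryValues (p q s : ℝ) (j : Fin 3) (x : ℝ) : Prop :=
  Tendsto (fun w => sol p q s w j) (upperNhds x) (𝓝 (solPlus p q s j x)) ∧
    Tendsto (fun w => sol p q s w j) (lowerNhds x) (𝓝 (solMinus p q s j x))

/-- The quotient `(z_{j+}(x,ξ) - z_{j-}(x,ξ)) / (z_{j+}(x,ξ) z_{j-}(x,ξ) x)`. -/
def jumpQuot (p q ξ : ℝ) (j : Fin 3) (x : ℝ) : ℂ :=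
  (solPlus p q ξ j x - solMinus p q ξ j x) / (solPlus p q ξ j x * solMinus p q ξ j x * x)

/-- The constant `c = ξ (ξ + p) (ξ + p + q) / (2πi)`. -/
def constC (p q ξ : ℝ) : ℂ :=
  ((ξ * (ξ + p) * (ξ + p + q) : ℝ) : ℂ) / (2 * Real.pi * Complex.I)

end Macdonald

end

noncomputable section

namespace Macdonald

open ComplexConjugate

/-! The substitution `z = -s (s + p) (s + p + q) / u`, `u = s + t`, turns `A_s(z) = x` into `t (t -
p) (t - p - q) = x (s + t)`. Decreasing `|z|` becomes increasing `|u|`, and `s` enters linearly, so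
along any zero `t(s)` the parameter `s` is an explicit function of `t`.

For real `x ≠ 0` one zero `T` (`branch`) is real for all `s`. The other two form a pair whose
discriminant `-negDisc` strictly decreases in `s` (`negDisc_branch_strictMonoOn`). Hence there is a
threshold `s₀(x)`: below it all zeros are real, above it the pair is complex conjugate
(`exists_threshold`). Comparing `(s + T)³` with the product of the zeros shows that the pair
consists of the two smaller zeros if `x > 0` and of the two larger ones if `x < 0`. So `Γ₁(s)` and
`Γ₂(s)` are the parts of the two half lines where `negDisc ≥ 0` (`mem_Gam_zero_iff`,
`mem_Gam_one_iff`).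

External fields: the integrand vanishes beyond `s₀`; before it, it is `±` the difference of `log |s
+ t|` at the two zeros of the pair. Passing from `s` to `t` gives an elementary primitive
(`logPrimitive`). The pair merges at `s₀`, so only the endpoint `s = 0` contributes, where the zeros
are `0` and `(2p + q ± √(q² + 4x)) / 2` (`integral_logRatio`).

Densities: at interior points of `Γ_j(s)` the density of `μ_jˢ` is `branchDensity`, and `π |x|`
times it is the `s`-derivative of the imaginary part of the pair (`hasDerivAt_imPart`). Tonelli and
the fundamental theorem of calculus give the density of `ν_j^ξ` as the increment of this imaginary
part from `0` to `ξ`, over `π ξ |x|`. The value at `ξ` is the jump quotient (`constC_mul_jumpQuot`);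
the value at `0` is nonzero only for `x < -q²/4`, and is the extra square root there. -/

/-- The cubic `t (t - p) (t - p - q) - x (s + t)`; its zeros `t` correspond to the solutions
`z = -s (s + p) (s + p + q) / (s + t)` of `A_s(z) = x`. -/
def realCubic (p q x s t : ℝ) : ℝ := t * (t - p) * (t - p - q) - x * (s + t)

/-- `T` is the zero of `realCubic` that is real for all `s`: the one above `p + q` if `x > 0`, the
one below `0` if `x < 0`. -/
def IsBranch (p q x s T : ℝ) : Prop :=
  realCubic p q x s T = 0 ∧ (0 < x → p + q < T) ∧ (x < 0 → T ≤ 0)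

/-- The derivative of `realCubic` in `t`. -/
def cubicDeriv (p q x t : ℝ) : ℝ := 3 * t ^ 2 - 2 * (2 * p + q) * t + p * (p + q) - x

/-- The negative of the discriminant of the quadratic factor which is left of `realCubic` after
division by `t - T`. -/
def negDisc (p q x T : ℝ) : ℝ := 3 * T ^ 2 - 2 * (2 * p + q) * T - q ^ 2 - 4 * x

open Classical in
/-- The zero of `realCubic` singled out by `IsBranch`. -/
def branch (p q x s : ℝ) : ℝ :=
  if h : x ≠ 0 ∧ 0 ≤ s ∧ ∃ T, IsBranch p q x s T then h.2.2.choose else 0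

/-! ### The real branch `T(x, s)`. -/

section Branch

variable {p q : ℝ} (hp : 0 < p) (hq : 0 < q) {x s T : ℝ}
include hp hq

/-- On the half line of the branch the cofactor of `y - T` is positive, so the sign of the cubic at
a test point tells on which side of `T` it lies. Uniqueness, monotonicity and continuity of the
branch all come from this. -/
theorem realCubic_sub (hx : x ≠ 0) (hs : 0 ≤ s) (hT : IsBranch p q x s T) {y : ℝ}
    (hy : 0 < x → p + q ≤ y) (hy' : x < 0 → y ≤ 0) :
    ∃ Q > 0, realCubic p q x s y = (y - T) * Q := by
  obtain ⟨h0, h1, h2⟩ := hT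
  unfold realCubic at *
  rcases lt_or_gt_of_ne hx with hx | hx
  · have hT := h2 hx
    have hy := hy' hx
    refine ⟨y ^ 2 + y * T + T ^ 2 - (2 * p + q) * (y + T) + p * (p + q) - x, ?_, ?_⟩
    · nlinarith [mul_nonneg_of_nonpos_of_nonpos hy hT, mul_pos hp (add_pos hp hq),
        mul_nonneg (by positivity : 0 ≤ 2 * p + q) (by linarith : 0 ≤ -(y + T)), sq_nonneg y,
        sq_nonneg T]
    · linear_combination h0
  · have hT := h1 hx
    have hy := hy hx
    have hT0 : 0 < T := by linarith
    -- For `x > 0` the cofactor has no evident sign; multiplying it by `T` and using the equation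
    -- for `T` removes the negative terms.
    refine ⟨(T * y * (y + T - 2 * p - q) + x * s) / T, ?_, ?_⟩
    · have : 0 < T * y * (y + T - 2 * p - q) :=
        mul_pos (mul_pos hT0 (by linarith)) (by linarith)
      positivity
    · field_simp
      linear_combination y * h0

theorem IsBranch.unique (hx : x ≠ 0) (hs : 0 ≤ s) (hT : IsBranch p q x s T) {y : ℝ}
    (hy : IsBranch p q x s y) : y = T := by
  obtain ⟨Q, hQ, h⟩ := realCubic_sub hp hq hx hs hT (fun h => (hy.2.1 h).le) hy.2.2
  rw [hy.1] at h
  have := (mul_eq_zero.1 h.symm).resolve_right hQ.ne'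
  linarith

theorem exists_isBranch (hx : x ≠ 0) (hs : 0 ≤ s) : ∃ T, IsBranch p q x s T := by
  have hc : Continuous (realCubic p q x s) := by unfold realCubic; fun_prop
  rcases lt_or_gt_of_ne hx with hx | hx
  · obtain ⟨T, hT, h⟩ := intermediate_value_Icc (a := -s) (b := 0) (by linarith) hc.continuousOn
      (show (0 : ℝ) ∈ Icc _ _ by
        constructor
        · have : 0 ≤ s * (s + p) * (s + p + q) := by positivity
          unfold realCubic; nlinarith
        · unfold realCubic; nlinarith [mul_nonneg hs (neg_pos.2 hx).le])
    exact ⟨T, h, fun h => absurd h (by linarith), fun _ => hT.2⟩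
  -- `M` is such that `(M - p) (M - p - q) ≥ q · x (s + 1) / q` and `M (s + 1) ≥ s + M`, which makes
  -- the cubic nonnegative at `M`.
  · set M := p + q + 1 + x * (s + 1) / q + x * (s + 1) with hM
    have hM0 : 0 < x * (s + 1) := by positivity
    have hM1 : 0 < x * (s + 1) / q := by positivity
    obtain ⟨T, hT, h⟩ := intermediate_value_Icc (a := p + q) (b := M) (by linarith)
      hc.continuousOn
      (show (0 : ℝ) ∈ Icc _ _ by
        constructor
        · have : 0 < x * (s + (p + q)) := by positivity
          unfold realCubic; nlinarith
        · have h1 : x * (s + 1) ≤ (M - p) * (M - p - q) := by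
            have a : x * (s + 1) = q * (x * (s + 1) / q) := by field_simp
            have : q ≤ M - p := by linarith
            have : x * (s + 1) / q ≤ M - p - q := by linarith
            rw [a]; exact mul_le_mul ‹_› ‹_› hM1.le (by linarith)
          have h2 : x * (s + M) ≤ M * (x * (s + 1)) := by
            have : 1 ≤ M := by linarith
            nlinarith [mul_nonneg hx.le (mul_nonneg hs (sub_nonneg.2 this))]
          have : M * (x * (s + 1)) ≤ M * ((M - p) * (M - p - q)) :=
            mul_le_mul_of_nonneg_left h1 (by linarith)
          unfold realCubic; nlinarith)
    refine ⟨T, h, fun _ => ?_, fun h => absurd h (by linarith)⟩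
    rcases hT.1.eq_or_lt with h' | h'
    · rw [← h'] at h
      unfold realCubic at h
      have : 0 < x * (s + (p + q)) := by positivity
      nlinarith
    · exact h'

theorem branch_spec (hx : x ≠ 0) (hs : 0 ≤ s) : IsBranch p q x s (branch p q x s) := by
  have h : x ≠ 0 ∧ 0 ≤ s ∧ ∃ T, IsBranch p q x s T := ⟨hx, hs, exists_isBranch hp hq hx hs⟩
  rw [branch, dif_pos h]
  exact h.2.2.choose_spec

theorem IsBranch.eq_branch (hx : x ≠ 0) (hs : 0 ≤ s) (hT : IsBranch p q x s T) :
    branch p q x s = T :=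
  hT.unique hp hq hx hs (branch_spec hp hq hx hs)

/-- Simplicity of the zero `T`. For `x > 0` one multiplies by `T` and eliminates the cubic term with
the equation. -/
theorem cubicDeriv_pos (hx : x ≠ 0) (hs : 0 ≤ s) (hT : IsBranch p q x s T) :
    0 < cubicDeriv p q x T := by
  obtain ⟨h0, h1, h2⟩ := hT
  unfold realCubic cubicDeriv at *
  rcases lt_or_gt_of_ne hx with hx | hx
  · have hT := h2 hx
    nlinarith [mul_nonneg (by positivity : 0 ≤ 2 * p + q) (neg_nonneg.2 hT), sq_nonneg T,
      mul_pos hp hq, sq_nonneg p]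
  · have hT := h1 hx
    have hT0 : 0 < T := by linarith
    have : 0 < T * (3 * T ^ 2 - 2 * (2 * p + q) * T + p * (p + q) - x) := by
      have h3 : T * (3 * T ^ 2 - 2 * (2 * p + q) * T + p * (p + q) - x)
          = T ^ 2 * (2 * T - (2 * p + q)) + x * s := by linear_combination h0
      rw [h3]
      have : 0 < 2 * T - (2 * p + q) := by linarith
      positivity
    exact pos_of_mul_pos_right this hT0.le

/-- `(3T - (2p + q)) / 2` is the distance from the centre of the pair to `T`, so `T` lies to the
right of the pair for `x > 0` and to the left for `x < 0`. -/
theorem IsBranch.mul_pos (hx : x ≠ 0) (hT : IsBranch p q x s T) :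
    0 < x * (3 * T - (2 * p + q)) := by
  rcases lt_or_gt_of_ne hx with hx | hx
  · exact mul_pos_of_neg_of_neg hx (by linarith [hT.2.2 hx])
  · exact _root_.mul_pos hx (by linarith [hT.2.1 hx])

theorem branch_lt_iff (hx : x ≠ 0) (hs : 0 ≤ s) {y : ℝ}
    (hy : 0 < x → p + q ≤ y) (hy' : x < 0 → y ≤ 0) :
    branch p q x s < y ↔ 0 < realCubic p q x s y := by
  obtain ⟨Q, hQ, h⟩ := realCubic_sub hp hq hx hs (branch_spec hp hq hx hs) hy hy'
  rw [h, mul_pos_iff_of_pos_right hQ, sub_pos]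

theorem lt_branch_iff (hx : x ≠ 0) (hs : 0 ≤ s) {y : ℝ}
    (hy : 0 < x → p + q ≤ y) (hy' : x < 0 → y ≤ 0) :
    y < branch p q x s ↔ realCubic p q x s y < 0 := by
  obtain ⟨Q, hQ, h⟩ := realCubic_sub hp hq hx hs (branch_spec hp hq hx hs) hy hy'
  rw [h, ← neg_pos, ← neg_mul, mul_pos_iff_of_pos_right hQ, neg_sub, sub_pos]

/-- At the parameter `s'` the cubic takes the value `-x (s' - s)` at the old branch point. -/
theorem branch_strictMonoOn (hx : 0 < x) : StrictMonoOn (branch p q x) (Ici 0) := by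
  intro s hs s' hs' h
  have hb := branch_spec hp hq hx.ne' hs
  rw [lt_branch_iff hp hq hx.ne' hs' (fun h => (hb.2.1 h).le) hb.2.2]
  have := hb.1
  unfold realCubic at *
  nlinarith

theorem branch_strictAntiOn (hx : x < 0) : StrictAntiOn (branch p q x) (Ici 0) := by
  intro s hs s' hs' h
  have hb := branch_spec hp hq hx.ne hs
  rw [branch_lt_iff hp hq hx.ne hs' (fun h => (hb.2.1 h).le) hb.2.2]
  have := hb.1
  unfold realCubic at *
  nlinarith

/-- Along the branch the discriminant of the quadratic factor is strictly decreasing in `s`. -/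
theorem negDisc_branch_strictMonoOn (hx : x ≠ 0) :
    StrictMonoOn (fun s => negDisc p q x (branch p q x s)) (Ici 0) := by
  intro s hs s' hs' h
  have hb := branch_spec hp hq hx hs
  have hb' := branch_spec hp hq hx hs'
  simp only [negDisc]
  -- In both cases `T` moves away from the vertex `(2p + q) / 3` of the parabola `negDisc`.
  rcases lt_or_gt_of_ne hx with hx | hx
  · have h1 := branch_strictAntiOn hp hq hx hs hs' h
    have h2 := hb.2.2 hx
    nlinarith
  · have h1 := branch_strictMonoOn hp hq hx hs hs' h
    have h2 := hb.2.1 hx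
    nlinarith

/-- Instead of estimating the branch for large `s`, one prescribes `T` far out and solves the cubic
for `s`, in which it is linear. -/
theorem exists_negDisc_branch_pos (hx : x ≠ 0) : ∃ s ≥ 0, 0 < negDisc p q x (branch p q x s) := by
  have key : ∀ T, (0 < x → p + q < T) → (x < 0 → T ≤ 0) → 0 ≤ T * ((T - p) * (T - p - q) / x - 1) →
      0 < negDisc p q x T → ∃ s ≥ 0, 0 < negDisc p q x (branch p q x s) := by
    intro T h1 h2 h3 h4
    refine ⟨_, h3, ?_⟩
    rwa [IsBranch.eq_branch hp hq hx h3 (T := T) ⟨?_, h1, h2⟩]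
    unfold realCubic
    field_simp
    ring
  rcases lt_or_gt_of_ne hx with hx | hx
  · refine key (-(q + 1)) (fun h => absurd h (by linarith)) (fun _ => by linarith) ?_ ?_
    · refine mul_nonneg_of_nonpos_of_nonpos (by linarith) ?_
      have : (-(q + 1) - p) * (-(q + 1) - p - q) / x ≤ 0 :=
        div_nonpos_of_nonneg_of_nonpos (mul_nonneg_of_nonpos_of_nonpos (by linarith)
          (by linarith)) hx.le
      linarith
    · unfold negDisc; nlinarith
  · refine key (2 * p + 2 * q + x + 4) (fun _ => by linarith) (fun h => absurd h (by linarith)) ?_ ?_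
    · refine mul_nonneg (by positivity) ?_
      have : 1 ≤ (2 * p + 2 * q + x + 4 - p) * (2 * p + 2 * q + x + 4 - p - q) / x := by
        rw [le_div_iff₀ hx]; nlinarith
      linarith
    · unfold negDisc; nlinarith

/-- A bound `a` within the half line of the branch is an open condition on `(x, s)`, namely the sign
of the cubic at `a`; a bound outside that half line holds automatically. -/
theorem continuousOn_branch :
    ContinuousOn (fun y : ℝ × ℝ => branch p q y.1 y.2) {y | y.1 ≠ 0 ∧ 0 ≤ y.2} := by
  rintro ⟨x, s⟩ ⟨hx, hs⟩
  simp only at hx hs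
  have hc : ∀ t, Continuous fun y : ℝ × ℝ => realCubic p q y.1 y.2 t := by
    intro t; unfold realCubic; fun_prop
  have hb := branch_spec hp hq hx hs
  have hmem : ∀ᶠ y in 𝓝[{y : ℝ × ℝ | y.1 ≠ 0 ∧ 0 ≤ y.2}] (x, s),
      y.1 ≠ 0 ∧ 0 ≤ y.2 := self_mem_nhdsWithin
  have hfst : Tendsto (fun y : ℝ × ℝ => y.1) (𝓝[{y : ℝ × ℝ | y.1 ≠ 0 ∧ 0 ≤ y.2}] (x, s)) (𝓝 x) :=
    (continuous_fst.tendsto (x, s)).mono_left nhdsWithin_le_nhds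
  rw [ContinuousWithinAt, tendsto_order]
  rcases lt_or_gt_of_ne hx with hx' | hx'
  · have hneg := hfst.eventually (gt_mem_nhds hx')
    constructor
    · intro a ha
      have ha0 : a ≤ 0 := ha.le.trans (hb.2.2 hx')
      have h := (lt_branch_iff hp hq hx hs (fun h => absurd h (by linarith)) (fun _ => ha0)).1 ha
      have := nhdsWithin_le_nhds (s := {y : ℝ × ℝ | y.1 ≠ 0 ∧ 0 ≤ y.2})
        ((hc a).tendsto (x, s) |>.eventually (gt_mem_nhds h))
      filter_upwards [this, hmem, hneg] with y h1 h2 h3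
      exact (lt_branch_iff hp hq h2.1 h2.2 (fun h => absurd h (by linarith)) (fun _ => ha0)).2 h1
    · intro a ha
      by_cases ha0 : a ≤ 0
      · have h := (branch_lt_iff hp hq hx hs (fun h => absurd h (by linarith)) (fun _ => ha0)).1 ha
        have := nhdsWithin_le_nhds (s := {y : ℝ × ℝ | y.1 ≠ 0 ∧ 0 ≤ y.2})
          ((hc a).tendsto (x, s) |>.eventually (lt_mem_nhds h))
        filter_upwards [this, hmem, hneg] with y h1 h2 h3
        exact (branch_lt_iff hp hq h2.1 h2.2 (fun h => absurd h (by linarith)) (fun _ => ha0)).2 h1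
      · filter_upwards [hmem, hneg] with y h2 h3
        linarith [(branch_spec hp hq h2.1 h2.2).2.2 h3]
  · have hpos := hfst.eventually (lt_mem_nhds hx')
    constructor
    · intro a ha
      by_cases ha0 : p + q ≤ a
      · have h := (lt_branch_iff hp hq hx hs (fun _ => ha0) (fun h => absurd h (by linarith))).1 ha
        have := nhdsWithin_le_nhds (s := {y : ℝ × ℝ | y.1 ≠ 0 ∧ 0 ≤ y.2})
          ((hc a).tendsto (x, s) |>.eventually (gt_mem_nhds h))
        filter_upwards [this, hmem, hpos] with y h1 h2 h3
        exact (lt_branch_iff hp hq h2.1 h2.2 (fun _ => ha0) (fun h => absurd h (by linarith))).2 h1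
      · filter_upwards [hmem, hpos] with y h2 h3
        linarith [(branch_spec hp hq h2.1 h2.2).2.1 h3]
    · intro a ha
      have ha0 : p + q ≤ a := ((hb.2.1 hx').trans ha).le
      have h := (branch_lt_iff hp hq hx hs (fun _ => ha0) (fun h => absurd h (by linarith))).1 ha
      have := nhdsWithin_le_nhds (s := {y : ℝ × ℝ | y.1 ≠ 0 ∧ 0 ≤ y.2})
        ((hc a).tendsto (x, s) |>.eventually (lt_mem_nhds h))
      filter_upwards [this, hmem, hpos] with y h1 h2 h3
      exact (branch_lt_iff hp hq h2.1 h2.2 (fun _ => ha0) (fun h => absurd h (by linarith))).2 h1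

theorem continuousOn_branch_right (hx : x ≠ 0) : ContinuousOn (branch p q x) (Ici 0) :=
  (continuousOn_branch hp hq).comp (f := fun s => (x, s)) (by fun_prop) fun _ hs => ⟨hx, hs⟩

theorem continuousOn_branch_left (hs : 0 ≤ s) :
    ContinuousOn (fun x => branch p q x s) {x | x ≠ 0} :=
  (continuousOn_branch hp hq).comp (f := fun x => (x, s)) (by fun_prop) fun _ hx => ⟨hx, hs⟩

omit hp hq in
/-- A continuous solution of `realCubic = 0` is differentiable in `s` where it is a simple zero. -/
theorem hasDerivAt_of_realCubic (hx : x ≠ 0) {f : ℝ → ℝ} (hc : ContinuousAt f s)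
    (hf : ∀ᶠ r in 𝓝 s, realCubic p q x r (f r) = 0) (hE : cubicDeriv p q x (f s) ≠ 0) :
    HasDerivAt f (x / cubicDeriv p q x (f s)) s := by
  -- The equation solved for `s`: `f` is a local inverse of this function.
  have hd : HasDerivAt (fun t => t * (t - p) * (t - p - q) / x - t)
      (cubicDeriv p q x (f s) / x) (f s) := by
    have h1 := hasDerivAt_id (f s)
    convert! ((((h1.mul (h1.sub_const p)).mul ((h1.sub_const p).sub_const q)).div_const x).sub h1)
      using 1
    simp only [id, Pi.mul_apply, cubicDeriv]
    field_simp
    ring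
  have := hd.of_local_left_inverse hc (div_ne_zero hE hx) ?_
  · rwa [inv_div] at this
  · filter_upwards [hf] with r hr
    unfold realCubic at hr
    field_simp
    linear_combination hr

theorem hasDerivAt_branch (hx : x ≠ 0) (hs : 0 < s) :
    HasDerivAt (branch p q x) (x / cubicDeriv p q x (branch p q x s)) s := by
  refine hasDerivAt_of_realCubic hx
    ((continuousOn_branch_right hp hq hx).continuousAt (Ici_mem_nhds hs)) ?_
    (cubicDeriv_pos hp hq hx hs.le (branch_spec hp hq hx hs.le)).ne'
  filter_upwards [lt_mem_nhds hs] with r hr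
  exact (branch_spec hp hq hx hr.le).1

end Branch

/-! ### The zeros in the variable `u`, sorted by absolute value. -/

/-- The cubic in `u` that `A_s(z) = x` becomes after the substitution
`z = -s (s + p) (s + p + q) / u`. -/
def uCubic (p q s : ℝ) (x u : ℂ) : ℂ := (u - s) * (u - (s + p)) * (u - (s + p + q)) - x * u

/-- `r₀, r₁, r₂` are the zeros of `uCubic`, by increasing absolute value. -/
def IsSortedRoots (p q s : ℝ) (x r₀ r₁ r₂ : ℂ) : Prop :=
  (∀ u, uCubic p q s x u = (u - r₀) * (u - r₁) * (u - r₂)) ∧ ‖r₀‖ ≤ ‖r₁‖ ∧ ‖r₁‖ ≤ ‖r₂‖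

/-- The product `s (s + p) (s + p + q)` of the zeros of `uCubic`. -/
def rootProd (p q s : ℝ) : ℝ := s * (s + p) * (s + p + q)

/-- The zeros of `uCubic` that correspond to `sol`. -/
def root (p q s : ℝ) (x : ℂ) (j : Fin 3) : ℂ := -(rootProd p q s : ℂ) / sol p q s x j

section Roots

variable {p q s : ℝ} {x r₀ r₁ r₂ t₀ t₁ t₂ : ℂ}

theorem IsSortedRoots.sum (h : IsSortedRoots p q s x r₀ r₁ r₂) :
    r₀ + r₁ + r₂ = 3 * s + 2 * p + q := by
  have h0 := h.1 0
  have h1 := h.1 1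
  have h2 := h.1 (-1)
  unfold uCubic at h0 h1 h2
  linear_combination (h1 + h2) / 2 - h0

theorem IsSortedRoots.prod (h : IsSortedRoots p q s x r₀ r₁ r₂) :
    r₀ * r₁ * r₂ = rootProd p q s := by
  have h0 := h.1 0
  unfold uCubic at h0
  unfold rootProd
  push_cast
  linear_combination h0

theorem IsSortedRoots.eq_or_of_root (h : IsSortedRoots p q s x r₀ r₁ r₂) {u : ℂ}
    (hu : uCubic p q s x u = 0) : u = r₀ ∨ u = r₁ ∨ u = r₂ := by
  rw [h.1, mul_eq_zero, mul_eq_zero, sub_eq_zero, sub_eq_zero, sub_eq_zero] at hu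
  tauto

theorem IsSortedRoots.eq_or (h : IsSortedRoots p q s x r₀ r₁ r₂)
    (h' : IsSortedRoots p q s x t₀ t₁ t₂) :
    (t₀ = r₀ ∨ t₀ = r₁ ∨ t₀ = r₂) ∧ (t₁ = r₀ ∨ t₁ = r₁ ∨ t₁ = r₂) ∧
      (t₂ = r₀ ∨ t₂ = r₁ ∨ t₂ = r₂) :=
  ⟨h.eq_or_of_root (by rw [h'.1]; ring), h.eq_or_of_root (by rw [h'.1]; ring),
    h.eq_or_of_root (by rw [h'.1]; ring)⟩

theorem rootProd_pos (hp : 0 < p) (hq : 0 < q) (hs : 0 < s) : 0 < rootProd p q s := by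
  unfold rootProd; positivity

/-- Ties may be broken differently in two sorted lists. The least and greatest moduli agree because
each list occurs in the other; the middle one agrees because the products do. -/
theorem IsSortedRoots.norm_eq (hP : 0 < rootProd p q s) (h : IsSortedRoots p q s x r₀ r₁ r₂)
    (h' : IsSortedRoots p q s x t₀ t₁ t₂) : ‖t₀‖ = ‖r₀‖ ∧ ‖t₁‖ = ‖r₁‖ ∧ ‖t₂‖ = ‖r₂‖ := by
  obtain ⟨a0, -, a2⟩ := h.eq_or h'
  obtain ⟨b0, -, b2⟩ := h'.eq_or h
  obtain ⟨-, hr, hr'⟩ := id h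
  obtain ⟨-, ht, ht'⟩ := id h'
  have e0 : ‖t₀‖ = ‖r₀‖ := by
    apply le_antisymm
    · rcases b0 with b | b | b <;> rw [b] <;> linarith
    · rcases a0 with b | b | b <;> rw [b] <;> linarith
  have e2 : ‖t₂‖ = ‖r₂‖ := by
    apply le_antisymm
    · rcases a2 with b | b | b <;> rw [b] <;> linarith
    · rcases b2 with b | b | b <;> rw [b] <;> linarith
  refine ⟨e0, ?_, e2⟩
  have hprod : t₀ * t₁ * t₂ = r₀ * r₁ * r₂ := h'.prod.trans h.prod.symm
  have hne : r₀ * r₁ * r₂ ≠ 0 := by rw [h.prod]; exact_mod_cast hP.ne'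
  have hn := congrArg norm hprod
  simp only [norm_mul, e0, e2] at hn
  have h0 : ‖r₀‖ ≠ 0 := by
    rw [norm_ne_zero_iff]; rintro rfl; simp at hne
  have h2 : ‖r₂‖ ≠ 0 := by
    rw [norm_ne_zero_iff]; rintro rfl; simp at hne
  exact mul_left_cancel₀ h0 (mul_right_cancel₀ h2 hn)

/-- Without ties the arbitrary choice in `sol` disappears; this identifies `root` with explicit
analytic functions. -/
theorem IsSortedRoots.eq_of_lt (hP : 0 < rootProd p q s) (h : IsSortedRoots p q s x r₀ r₁ r₂)
    (h' : IsSortedRoots p q s x t₀ t₁ t₂) (h1 : ‖r₀‖ < ‖r₁‖) (h2 : ‖r₁‖ < ‖r₂‖) :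
    t₀ = r₀ ∧ t₁ = r₁ ∧ t₂ = r₂ := by
  obtain ⟨a0, a1, a2⟩ := h.eq_or h'
  obtain ⟨n0, n1, n2⟩ := h.norm_eq hP h'
  refine ⟨?_, ?_, ?_⟩
  · rcases a0 with rfl | rfl | rfl <;> first | rfl | linarith
  · rcases a1 with rfl | rfl | rfl <;> first | rfl | linarith
  · rcases a2 with rfl | rfl | rfl <;> first | rfl | linarith

theorem sol_prod (p q s : ℝ) (x : ℂ) :
    sol p q s x 0 * sol p q s x 1 * sol p q s x 2 = -(rootProd p q s : ℂ) ^ 2 := by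
  have h := (sol_spec p q s x).1
  -- The factorization is only known for `w ≠ 0`, so the constant coefficient is recovered by
  -- interpolation at `±1, ±2`.
  have h1 := h 1 one_ne_zero
  have h2 := h (-1) (by norm_num)
  have h3 := h 2 (by norm_num)
  have h4 := h (-2) (by norm_num)
  unfold symbol at h1 h2 h3 h4
  have hd : (coeffD p q s : ℂ) = (rootProd p q s : ℂ) ^ 2 := by
    unfold coeffD rootProd; push_cast; ring
  rw [← hd]
  field_simp at h1 h2 h3 h4
  linear_combination (4 * (h1 + h2) - (h3 + h4)) / 6

theorem sol_ne_zero (hP : 0 < rootProd p q s) (x : ℂ) (j : Fin 3) : sol p q s x j ≠ 0 := by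
  have h := sol_prod p q s x
  have hne : -(rootProd p q s : ℂ) ^ 2 ≠ 0 :=
    neg_ne_zero.2 (pow_ne_zero _ (by exact_mod_cast hP.ne'))
  rw [← h] at hne
  fin_cases j
  · exact left_ne_zero_of_mul (left_ne_zero_of_mul hne)
  · exact right_ne_zero_of_mul (left_ne_zero_of_mul hne)
  · exact right_ne_zero_of_mul hne

theorem root_ne_zero (hP : 0 < rootProd p q s) (x : ℂ) (j : Fin 3) : root p q s x j ≠ 0 :=
  div_ne_zero (neg_ne_zero.2 (by exact_mod_cast hP.ne')) (sol_ne_zero hP x j)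

theorem sol_eq (hP : 0 < rootProd p q s) (x : ℂ) (j : Fin 3) :
    sol p q s x j = -(rootProd p q s : ℂ) / root p q s x j := by
  have h1 := sol_ne_zero hP x j
  have h2 : (rootProd p q s : ℂ) ≠ 0 := by exact_mod_cast hP.ne'
  unfold root
  field_simp

/-- With `e₁, e₂, e₃` the elementary symmetric functions of `s, s + p, s + p + q`, the coefficients
are `b = e₂`, `c = e₁ e₃`, `d = e₃²`; hence `z ↦ -e₃ / z` maps one cubic to the other. The point `u
= 0` corresponds to no finite `z` and is settled by the product of the zeros. -/
theorem root_spec (hP : 0 < rootProd p q s) (x : ℂ) :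
    IsSortedRoots p q s x (root p q s x 0) (root p q s x 1) (root p q s x 2) := by
  obtain ⟨h, h1, h2⟩ := sol_spec p q s x
  have hne : (rootProd p q s : ℂ) ≠ 0 := by exact_mod_cast hP.ne'
  have z0 := sol_ne_zero hP x 0
  have z1 := sol_ne_zero hP x 1
  have z2 := sol_ne_zero hP x 2
  have hz := sol_prod p q s x
  have hroot : root p q s x 0 * root p q s x 1 * root p q s x 2 = rootProd p q s := by
    unfold root
    field_simp
    linear_combination -hz
  refine ⟨fun u => ?_, ?_, ?_⟩
  · by_cases hu : u = 0
    · subst hu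
      have : uCubic p q s x 0 = -(rootProd p q s : ℂ) := by
        unfold uCubic rootProd; push_cast; ring
      rw [this]
      linear_combination hroot
    · have key := h (-(rootProd p q s : ℂ) / u) (div_ne_zero (neg_ne_zero.2 hne) hu)
      have e1 : (-(rootProd p q s : ℂ) / u) ^ 2 * (symbol p q s (-(rootProd p q s : ℂ) / u) - x)
          = (rootProd p q s : ℂ) ^ 2 * uCubic p q s x u / u ^ 3 := by
        have hB : (coeffB p q s : ℂ) = s * (s + p) + (s + p) * (s + p + q) + s * (s + p + q) := by
          unfold coeffB; push_cast; ring
        have hC : (coeffC p q s : ℂ) = rootProd p q s * (3 * s + 2 * p + q) := by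
          unfold coeffC rootProd; push_cast; ring
        have hD : (coeffD p q s : ℂ) = (rootProd p q s : ℂ) ^ 2 := by
          unfold coeffD rootProd; push_cast; ring
        have hR : (rootProd p q s : ℂ) = s * (s + p) * (s + p + q) := by
          unfold rootProd; push_cast; ring
        unfold symbol uCubic
        rw [hB, hC, hD]
        field_simp
        rw [hR]
        ring
      have e2 : (-(rootProd p q s : ℂ) / u - sol p q s x 0) * (-(rootProd p q s : ℂ) / u - sol p q s x 1)
          * (-(rootProd p q s : ℂ) / u - sol p q s x 2) =
          (rootProd p q s : ℂ) ^ 2 *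
            ((u - root p q s x 0) * (u - root p q s x 1) * (u - root p q s x 2)) / u ^ 3 := by
        unfold root
        field_simp
        linear_combination ((rootProd p q s : ℂ) + u * sol p q s x 0) *
          ((rootProd p q s : ℂ) + u * sol p q s x 1) *
          ((rootProd p q s : ℂ) + u * sol p q s x 2) * (-1) * hz
      rw [e1, e2] at key
      field_simp at key
      exact key
  · simp only [root, norm_div]
    exact div_le_div_of_nonneg_left (norm_nonneg _) (norm_pos_iff.2 z1) h1
  · simp only [root, norm_div]
    exact div_le_div_of_nonneg_left (norm_nonneg _) (norm_pos_iff.2 z2) h2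

/-- For large `|u|` each factor has modulus at least `|u| / 2`, whence `|u|² ≤ 8 |x|`. The bound is
locally uniform in `x` and supplies the compactness in `tendsto_root`. -/
theorem norm_root_le (hp : 0 < p) (hq : 0 < q) (hs : 0 < s) {u : ℂ} (hu : uCubic p q s x u = 0) :
    ‖u‖ ≤ 2 * (s + p + q) + 8 * ‖x‖ + 1 := by
  by_contra! hlt
  have hx := norm_nonneg x
  have h1 : ∀ a : ℝ, 0 ≤ a → a ≤ s + p + q → ‖u‖ / 2 ≤ ‖u - (a : ℂ)‖ := by
    intro a ha ha'
    have := norm_sub_norm_le u (a : ℂ)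
    rw [Complex.norm_real, Real.norm_of_nonneg ha] at this
    linarith
  have e : (u - s) * (u - ((s + p : ℝ) : ℂ)) * (u - ((s + p + q : ℝ) : ℂ)) = x * u := by
    unfold uCubic at hu
    push_cast
    linear_combination hu
  have e' := congrArg norm e
  rw [norm_mul, norm_mul, norm_mul] at e'
  have a1 := h1 s hs.le (by linarith)
  have a2 := h1 (s + p) (by linarith) (by linarith)
  have a3 := h1 (s + p + q) (by linarith) le_rfl
  have hu0 : 0 < ‖u‖ := by linarith
  have : ‖u‖ / 2 * (‖u‖ / 2) * (‖u‖ / 2) ≤ ‖x‖ * ‖u‖ := by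
    rw [← e']; gcongr
  nlinarith [mul_pos hu0 hu0]

/-- If the `j`-th sorted zero at `x` is determined, then it is continuous at `x`. -/
theorem tendsto_root (hp : 0 < p) (hq : 0 < q) (hs : 0 < s) {j : Fin 3} {R : ℂ}
    (h : ∀ r : Fin 3 → ℂ, IsSortedRoots p q s x (r 0) (r 1) (r 2) → r j = R) :
    Tendsto (fun w => root p q s w j) (𝓝 x) (𝓝 R) := by
  have hP := rootProd_pos hp hq hs
  -- Along an ultrafilter the bounded triples of zeros converge. The limit is a sorted triple at
  -- `x`, so its `j`-th entry is `R`.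
  rw [tendsto_iff_ultrafilter]
  intro g hg
  have hbd : ∀ᶠ w in (g : Filter ℂ), root p q s w ∈
      Metric.closedBall (0 : Fin 3 → ℂ) (2 * (s + p + q) + 8 * (‖x‖ + 1) + 1) := by
    filter_upwards [hg (Metric.ball_mem_nhds x one_pos)] with w hw
    have hw' : ‖w‖ ≤ ‖x‖ + 1 := by
      have := norm_sub_norm_le w x
      rw [mem_ball_iff_norm] at hw
      linarith
    rw [mem_closedBall_zero_iff, pi_norm_le_iff_of_nonneg (by positivity)]
    intro i
    refine (norm_root_le (x := w) hp hq hs ?_).trans (by linarith)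
    rw [(root_spec hP w).1]
    fin_cases i <;> simp
  obtain ⟨r, -, hr⟩ := (isCompact_closedBall (0 : Fin 3 → ℂ)
    (2 * (s + p + q) + 8 * (‖x‖ + 1) + 1)).ultrafilter_le_nhds (g.map (root p q s))
    (le_principal_iff.2 hbd)
  have hr' : Tendsto (root p q s) g (𝓝 r) := hr
  have hi : ∀ i, Tendsto (fun w => root p q s w i) g (𝓝 (r i)) := fun i =>
    tendsto_pi_nhds.1 hr' i
  have hgx : Tendsto (fun w : ℂ => w) g (𝓝 x) := hg
  suffices hs : IsSortedRoots p q s x (r 0) (r 1) (r 2) by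
    rw [← h r hs]; exact hi j
  refine ⟨fun u => ?_, ?_, ?_⟩
  · have t1 : Tendsto (fun w => uCubic p q s w u) g (𝓝 (uCubic p q s x u)) := by
      unfold uCubic
      exact tendsto_const_nhds.sub (hgx.mul_const u)
    have t2 := ((tendsto_const_nhds (x := u)).sub (hi 0)).mul
      ((tendsto_const_nhds (x := u)).sub (hi 1)) |>.mul ((tendsto_const_nhds (x := u)).sub (hi 2))
    refine tendsto_nhds_unique t1 (t2.congr fun w => ?_)
    rw [(root_spec hP w).1]
  · exact le_of_tendsto_of_tendsto' (hi 0).norm (hi 1).norm fun w => (root_spec hP w).2.1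
  · exact le_of_tendsto_of_tendsto' (hi 1).norm (hi 2).norm fun w => (root_spec hP w).2.2

theorem uCubic_factor {a b : ℂ} (ha : uCubic p q s x a = 0) (hb : uCubic p q s x b = 0)
    (hab : a ≠ b) (u : ℂ) :
    uCubic p q s x u = (u - a) * (u - b) * (u - (3 * s + 2 * p + q - a - b)) := by
  unfold uCubic at *
  have h : a ^ 2 + a * b + b ^ 2 - (3 * s + 2 * p + q) * (a + b)
      + (s * (s + p) + (s + p) * (s + p + q) + s * (s + p + q)) - x = 0 := by
    refine mul_left_cancel₀ (sub_ne_zero.2 hab) ?_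
    linear_combination ha - hb
  linear_combination h * (u - a) + ha

theorem uCubic_conj (p q s : ℝ) (x u : ℂ) :
    uCubic p q s (conj x) (conj u) = conj (uCubic p q s x u) := by
  simp [uCubic]

end Roots

/-! ### Approach to the real line near a conjugate pair. -/

section Boundary

theorem upperNhds_neBot (x : ℝ) : (upperNhds x).NeBot := by
  apply mem_closure_iff_nhdsWithin_neBot.1
  rw [Complex.closure_setOfPred_lt_im]
  simp

theorem lowerNhds_neBot (x : ℝ) : (lowerNhds x).NeBot := by
  apply mem_closure_iff_nhdsWithin_neBot.1
  rw [Complex.closure_setOfPred_im_lt]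
  simp

theorem tendsto_conj_lowerNhds (x : ℝ) : Tendsto (conj : ℂ → ℂ) (lowerNhds x) (upperNhds x) := by
  refine tendsto_nhdsWithin_iff.2 ⟨?_, ?_⟩
  · have := (Complex.continuous_conj.tendsto (x : ℂ)).mono_left
      (nhdsWithin_le_nhds (s := {w : ℂ | w.im < 0}))
    rwa [Complex.conj_ofReal] at this
  · filter_upwards [self_mem_nhdsWithin] with w hw
    simpa using hw

theorem tendsto_conj_upperNhds (x : ℝ) : Tendsto (conj : ℂ → ℂ) (upperNhds x) (lowerNhds x) := by
  refine tendsto_nhdsWithin_iff.2 ⟨?_, ?_⟩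
  · have := (Complex.continuous_conj.tendsto (x : ℂ)).mono_left
      (nhdsWithin_le_nhds (s := {w : ℂ | 0 < w.im}))
    rwa [Complex.conj_ofReal] at this
  · filter_upwards [self_mem_nhdsWithin] with w hw
    simpa using hw

/-- From `|a|² - |b|² = Re ((a - b) conj (a + b))` with `a = φ w`, `b = φ (conj w)`, and `a - b ≈ 2
i d Im w`. Strict differentiability is needed because both points move. -/
theorem lt_norm_conj_of_hasStrictDerivAt {φ : ℂ → ℂ} {x : ℝ} {d : ℂ}
    (h : HasStrictDerivAt φ d x) (hd : (Complex.I * d * conj (φ x)).re < 0) :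
    ∀ᶠ w in upperNhds x, ‖φ w‖ < ‖φ (conj w)‖ := by
  have hw : Tendsto (fun w : ℂ => w) (upperNhds x) (𝓝 (x : ℂ)) := nhdsWithin_le_nhds
  have hc : Tendsto (conj : ℂ → ℂ) (upperNhds x) (𝓝 (x : ℂ)) :=
    (tendsto_conj_upperNhds x).mono_right nhdsWithin_le_nhds
  have hne : ∀ᶠ w in upperNhds x, w - conj w ≠ 0 := by
    filter_upwards [self_mem_nhdsWithin] with w hw h0
    have := congrArg Complex.im h0
    simp at this
    have hw : 0 < w.im := hw
    linarith
  have hlo := (h.isLittleO.comp_tendsto (hw.prodMk_nhds hc)).tendsto_div_nhds_zero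
  have hslope : Tendsto (fun w => (φ w - φ (conj w)) / (w - conj w)) (upperNhds x) (𝓝 d) := by
    have := hlo.add_const d
    rw [zero_add] at this
    refine this.congr' ?_
    filter_upwards [hne] with w hw
    simp only [Function.comp, smul_eq_mul, ContinuousLinearMap.toSpanSingleton_apply]
    field_simp
    ring
  have hsum : Tendsto (fun w => conj (φ w + φ (conj w))) (upperNhds x)
      (𝓝 (conj (φ x + φ x))) := by
    refine (Complex.continuous_conj.tendsto _).comp ?_
    exact (h.hasDerivAt.continuousAt.tendsto.comp hw).add (h.hasDerivAt.continuousAt.tendsto.comp hc)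
  have hlim := (Complex.continuous_re.tendsto _).comp
    ((tendsto_const_nhds (x := Complex.I)).mul hslope |>.mul hsum)
  have hlt : (Complex.I * d * conj (φ x + φ x)).re < 0 := by
    have : Complex.I * d * conj (φ x + φ x) = 2 * (Complex.I * d * conj (φ x)) := by
      rw [map_add]; ring
    rw [this, show (2 : ℂ) = ((2 : ℝ) : ℂ) by norm_num, Complex.re_ofReal_mul]
    linarith
  filter_upwards [hlim.eventually (gt_mem_nhds hlt), hne, self_mem_nhdsWithin] with w h1 h2 h3
  have h3 : 0 < w.im := h3
  have hsq : ‖φ w‖ ^ 2 - ‖φ (conj w)‖ ^ 2 = 2 * w.im *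
      (Complex.I * ((φ w - φ (conj w)) / (w - conj w)) * conj (φ w + φ (conj w))).re := by
    have e1 : (φ w - φ (conj w)) * conj (φ w + φ (conj w)) = ((2 * w.im : ℝ) : ℂ) *
        (Complex.I * ((φ w - φ (conj w)) / (w - conj w)) * conj (φ w + φ (conj w))) := by
      have : (w - conj w) = ((2 * w.im : ℝ) : ℂ) * Complex.I := by
        rw [Complex.sub_conj]
      field_simp
      rw [this]
      ring
    have e2 := congrArg Complex.re e1
    rw [Complex.re_ofReal_mul] at e2
    rw [← e2, Complex.sq_norm, Complex.sq_norm, Complex.normSq_apply, Complex.normSq_apply]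
    simp
    ring
  have : ‖φ w‖ ^ 2 - ‖φ (conj w)‖ ^ 2 < 0 := by
    rw [hsq]
    exact mul_neg_of_pos_of_neg (by linarith) h1
  exact lt_of_pow_lt_pow_left₀ 2 (norm_nonneg _) (by linarith)

/-- Near a real point with a pair of complex conjugate zeros, these zeros form an analytic function
and its conjugate, and they differ in absolute value off the real line. -/
theorem exists_analytic_root {p q s x v : ℝ} {U : ℂ}
    (hfac : ∀ u, uCubic p q s x u = (u - v) * (u - U) * (u - conj U))
    (hU : 0 < (v - U.re) * U.im) :
    ∃ φ : ℂ → ℂ, AnalyticAt ℂ φ x ∧ φ x = U ∧ deriv φ x = U / ((U - v) * (U - conj U)) ∧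
      (∀ᶠ w in 𝓝 (x : ℂ), ∀ u, uCubic p q s w u =
        (u - φ w) * (u - conj (φ (conj w))) *
          (u - (3 * s + 2 * p + q - φ w - conj (φ (conj w))))) ∧
      ∀ᶠ w in upperNhds x, ‖φ w‖ < ‖φ (conj w)‖ := by
  have him : U.im ≠ 0 := by rintro h; simp [h] at hU
  have hU0 : U ≠ 0 := by rintro rfl; simp at him
  have hUv : U - v ≠ 0 := by
    intro h
    have := congrArg Complex.im h
    simp at this
    exact him this
  have hUU : U - conj U = 2 * U.im * Complex.I := by
    rw [Complex.sub_conj]; push_cast; ring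
  have hUc : U - conj U ≠ 0 := by
    rw [hUU]
    simp [him]
  -- `f u` is the parameter for which `u` is a zero of the cubic; `φ` is its local inverse at `U`.
  set f : ℂ → ℂ := fun u => x + (u - v) * (u - U) * (u - conj U) / u with hf
  have hfU : f U = x := by simp [hf]
  have hfan : AnalyticAt ℂ f U := by
    have : ∀ a : ℂ, AnalyticAt ℂ (fun u : ℂ => u - a) U := fun a => analyticAt_id.sub analyticAt_const
    exact analyticAt_const.add ((((this v).mul (this U)).mul (this _)).div analyticAt_id hU0)
  have hfd : deriv f U = (U - v) * (U - conj U) / U := by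
    apply HasDerivAt.deriv
    have h1 := hasDerivAt_id U
    convert! ((((h1.sub_const (v : ℂ)).mul (h1.sub_const U)).mul (h1.sub_const (conj U))).div
      h1 hU0).const_add (x : ℂ) using 1
    simp
    field_simp
  have hfd0 : deriv f U ≠ 0 := by
    rw [hfd]; exact div_ne_zero (mul_ne_zero hUv hUc) hU0
  set φ := hfan.hasStrictDerivAt.localInverse _ _ _ hfd0 with hφ
  have hφan : AnalyticAt ℂ φ x := hfU ▸ hfan.analyticAt_localInverse hfd0
  have hφx : φ x = U := by
    rw [← hfU]; exact HasStrictFDerivAt.localInverse_apply_image ..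
  have hφd : HasStrictDerivAt φ (U / ((U - v) * (U - conj U))) x := by
    have := hfan.hasStrictDerivAt.to_localInverse hfd0
    rw [← inv_div, ← hfd, ← hfU]
    exact this
  have hright : ∀ᶠ w in 𝓝 (x : ℂ), f (φ w) = w := by
    have := hfan.hasStrictDerivAt.eventually_right_inverse hfd0
    rwa [hfU] at this
  have hconj : Tendsto (conj : ℂ → ℂ) (𝓝 (x : ℂ)) (𝓝 (x : ℂ)) := by
    have := Complex.continuous_conj.tendsto (x : ℂ)
    rwa [Complex.conj_ofReal] at this
  have hφc : Tendsto φ (𝓝 (x : ℂ)) (𝓝 U) := by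
    have := hφan.continuousAt.tendsto
    rwa [hφx] at this
  have hroot : ∀ᶠ w in 𝓝 (x : ℂ), uCubic p q s w (φ w) = 0 := by
    filter_upwards [hright, hφc.eventually_ne hU0] with w h1 h2
    have e : uCubic p q s w (φ w) = uCubic p q s x (φ w) - (w - x) * φ w := by
      unfold uCubic; ring
    rw [e, hfac]
    simp only [hf] at h1
    field_simp at h1
    linear_combination h1
  have hroot' : ∀ᶠ w in 𝓝 (x : ℂ), uCubic p q s w (conj (φ (conj w))) = 0 := by
    filter_upwards [hconj.eventually hroot] with w h1
    have := uCubic_conj p q s (conj w) (φ (conj w))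
    rw [h1, Complex.conj_conj, map_zero] at this
    exact this
  have hne : ∀ᶠ w in 𝓝 (x : ℂ), φ w - conj (φ (conj w)) ≠ 0 := by
    have h1 : Tendsto (fun w => conj (φ (conj w))) (𝓝 (x : ℂ)) (𝓝 (conj U)) :=
      (Complex.continuous_conj.tendsto U).comp (hφc.comp hconj)
    exact (hφc.sub h1).eventually_ne hUc
  refine ⟨φ, hφan, hφx, hφd.hasDerivAt.deriv, ?_, ?_⟩
  · filter_upwards [hroot, hroot', hne] with w h1 h2 h3
    exact uCubic_factor h1 h2 (sub_ne_zero.1 h3)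
  · refine lt_norm_conj_of_hasStrictDerivAt hφd ?_
    rw [hφx]
    -- The quantity is `|U|² / (2 Im U) · Re (U - v)⁻¹`; it is negative since `hU` gives `Im U` and
    -- `Re U - v` opposite signs.
    have e : Complex.I * (U / ((U - v) * (U - conj U))) * conj U
        = ((Complex.normSq U / (2 * U.im) : ℝ) : ℂ) * (U - v)⁻¹ := by
      push_cast
      rw [hUU, ← Complex.mul_conj]
      have : (U.im : ℂ) ≠ 0 := by exact_mod_cast him
      have := Complex.I_ne_zero
      field_simp
    rw [e, Complex.re_ofReal_mul, Complex.inv_re]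
    have h1 : 0 < Complex.normSq U := Complex.normSq_pos.2 hU0
    have h2 : 0 < Complex.normSq (U - v) := Complex.normSq_pos.2 hUv
    have h3 : (U.re - v) / U.im < 0 := by
      have : (U.re - v) / U.im = -((v - U.re) * U.im) / U.im ^ 2 := by
        field_simp; ring
      rw [this]
      exact div_neg_of_neg_of_pos (by linarith) (by positivity)
    have e2 : Complex.normSq U / (2 * U.im) * ((U - v).re / Complex.normSq (U - v))
        = Complex.normSq U / (2 * Complex.normSq (U - v)) * ((U.re - v) / U.im) := by
      simp
      field_simp
    rw [e2]
    exact mul_neg_of_pos_of_neg (by positivity) h3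

end Boundary

/-! ### Zeros at real points and the sets `Γ_j(s)`. -/

/-- Half the sum of the two zeros of `uCubic` that are left when `s + T` is split off. -/
def midpoint (p q s T : ℝ) : ℝ := s + (2 * p + q - T) / 2

section RealAxis

variable {p q s x T : ℝ}

theorem uCubic_eq (hT : realCubic p q x s T = 0) (u : ℂ) :
    uCubic p q s x u = (u - (s + T : ℝ)) *
      ((u - midpoint p q s T) ^ 2 + (negDisc p q x T / 4 : ℝ)) := by
  have h := congrArg (fun y : ℝ => (y : ℂ)) hT
  unfold realCubic at h
  unfold uCubic midpoint negDisc
  push_cast at h ⊢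
  linear_combination h

theorem mul_midpoint_sq (hT : realCubic p q x s T = 0) :
    (s + T) * (midpoint p q s T ^ 2 + negDisc p q x T / 4) = rootProd p q s := by
  unfold realCubic at hT
  unfold rootProd midpoint negDisc
  linear_combination hT

/-- Both sides are the derivative of the cubic at the split-off zero. If the pair is not real, this
is the squared distance from `s + T` to either of its members. -/
theorem sub_midpoint_sq : (s + T - midpoint p q s T) ^ 2 + negDisc p q x T / 4
    = cubicDeriv p q x T := by
  unfold midpoint negDisc cubicDeriv; ring

variable (hp : 0 < p) (hq : 0 < q)
include hp hq

theorem IsBranch.add_pos (hx : x ≠ 0) (hs : 0 < s) (hT : IsBranch p q x s T) : 0 < s + T := by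
  rcases lt_or_gt_of_ne hx with hx' | hx'
  · rw [← hT.eq_branch hp hq hx hs.le]
    have := (lt_branch_iff hp hq hx hs.le (y := -s) (fun h => absurd h (by linarith))
      (fun _ => by linarith)).2 (by
        have : 0 < s * (s + p) * (s + p + q) := by positivity
        unfold realCubic; nlinarith)
    linarith
  · linarith [hT.2.1 hx']

theorem IsBranch.neg (hx : x < 0) (hs : 0 < s) (hT : IsBranch p q x s T) : T < 0 := by
  rw [← hT.eq_branch hp hq hx.ne hs.le, branch_lt_iff hp hq hx.ne hs.le
    (fun h => absurd h (by linarith)) (fun _ => le_rfl)]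
  unfold realCubic; nlinarith

/-- As `T > p + q`, each of `s, s + p, s + p + q` is below `s + T`. By `mul_midpoint_sq` a conjugate
pair then has modulus below `s + T`. -/
theorem IsBranch.rootProd_lt (hx : 0 < x) (hs : 0 < s) (hT : IsBranch p q x s T) :
    rootProd p q s < (s + T) ^ 3 := by
  have h := hT.2.1 hx
  unfold rootProd
  calc s * (s + p) * (s + p + q) ≤ (s + T) * (s + T) * (s + p + q) := by
        refine mul_le_mul_of_nonneg_right (mul_le_mul ?_ ?_ ?_ ?_) ?_ <;> linarith
    _ < (s + T) * (s + T) * (s + T) := by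
        have : 0 < s + T := by linarith
        exact mul_lt_mul_of_pos_left (by linarith) (by positivity)
    _ = _ := by ring

theorem IsBranch.lt_rootProd (hx : x < 0) (hs : 0 < s) (hT : IsBranch p q x s T) :
    (s + T) ^ 3 < rootProd p q s := by
  have h := hT.neg hp hq hx hs
  have h1 := hT.add_pos hp hq hx.ne hs
  unfold rootProd
  calc (s + T) ^ 3 = (s + T) * (s + T) * (s + T) := by ring
    _ < (s + T) * (s + T) * (s + p + q) := by
        refine mul_lt_mul_of_pos_left ?_ (by positivity); linarith
    _ ≤ s * (s + p) * (s + p + q) := by gcongr <;> linarith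

omit hp hq in
theorem normSq_add_mul_I (A ε : ℝ) : ‖(A : ℂ) + ε * Complex.I‖ ^ 2 = A ^ 2 + ε ^ 2 := by
  rw [Complex.sq_norm, Complex.normSq_add_mul_I]

theorem IsBranch.norm_lt (hx : 0 < x) (hs : 0 < s) (hT : IsBranch p q x s T) {ε : ℝ}
    (hε : ε ^ 2 = negDisc p q x T / 4) :
    ‖(midpoint p q s T : ℂ) + ε * Complex.I‖ < ‖((s + T : ℝ) : ℂ)‖ := by
  have hv := hT.add_pos hp hq hx.ne' hs
  have h1 := hT.rootProd_lt hp hq hx hs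
  rw [← mul_midpoint_sq hT.1, ← hε, ← normSq_add_mul_I] at h1
  rw [Complex.norm_real, Real.norm_of_nonneg hv.le]
  refine lt_of_pow_lt_pow_left₀ 2 hv.le (lt_of_mul_lt_mul_left ?_ hv.le)
  linarith [pow_succ (s + T) 2]

theorem IsBranch.lt_norm (hx : x < 0) (hs : 0 < s) (hT : IsBranch p q x s T) {ε : ℝ}
    (hε : ε ^ 2 = negDisc p q x T / 4) :
    ‖((s + T : ℝ) : ℂ)‖ < ‖(midpoint p q s T : ℂ) + ε * Complex.I‖ := by
  have hv := hT.add_pos hp hq hx.ne hs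
  have h1 := hT.lt_rootProd hp hq hx hs
  rw [← mul_midpoint_sq hT.1, ← hε, ← normSq_add_mul_I] at h1
  rw [Complex.norm_real, Real.norm_of_nonneg hv.le]
  refine lt_of_pow_lt_pow_left₀ 2 (norm_nonneg _) (lt_of_mul_lt_mul_left ?_ hv.le)
  linarith [pow_succ (s + T) 2]

omit hp hq in
theorem norm_sub_eq_norm_add (A ε : ℝ) :
    ‖(A : ℂ) - ε * Complex.I‖ = ‖(A : ℂ) + ε * Complex.I‖ := by
  rw [← sq_eq_sq₀ (norm_nonneg _) (norm_nonneg _), normSq_add_mul_I, sub_eq_add_neg, ← neg_mul,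
    ← Complex.ofReal_neg, normSq_add_mul_I, neg_sq]

omit hp hq in
theorem uCubic_eq_of_sq (hT : realCubic p q x s T = 0) {ε : ℝ}
    (hε : ε ^ 2 = negDisc p q x T / 4) (u : ℂ) :
    uCubic p q s x u = (u - (midpoint p q s T + ε * Complex.I)) *
      (u - (midpoint p q s T - ε * Complex.I)) * (u - (s + T : ℝ)) := by
  rw [uCubic_eq hT, ← hε]
  push_cast
  linear_combination ((u - (s + T)) * (ε : ℂ) ^ 2) * Complex.I_sq

theorem IsBranch.sortedRoots_of_pos (hx : 0 < x) (hs : 0 < s) (hT : IsBranch p q x s T) {ε : ℝ}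
    (hε : ε ^ 2 = negDisc p q x T / 4) :
    IsSortedRoots p q s x (midpoint p q s T + ε * Complex.I) (midpoint p q s T - ε * Complex.I)
      (s + T : ℝ) := by
  refine ⟨uCubic_eq_of_sq hT.1 hε, (norm_sub_eq_norm_add _ _).ge, ?_⟩
  rw [norm_sub_eq_norm_add]
  exact (hT.norm_lt hp hq hx hs hε).le

theorem IsBranch.sortedRoots_of_neg (hx : x < 0) (hs : 0 < s) (hT : IsBranch p q x s T) {ε : ℝ}
    (hε : ε ^ 2 = negDisc p q x T / 4) :
    IsSortedRoots p q s x (s + T : ℝ) (midpoint p q s T + ε * Complex.I)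
      (midpoint p q s T - ε * Complex.I) := by
  refine ⟨fun u => ?_, (hT.lt_norm hp hq hx hs hε).le, (norm_sub_eq_norm_add _ _).ge⟩
  rw [uCubic_eq_of_sq hT.1 hε]
  ring

omit hp hq in
theorem uCubic_eq_of_neg_sq (hT : realCubic p q x s T = 0) {δ : ℝ}
    (hδ : δ ^ 2 = -negDisc p q x T / 4) (u : ℂ) :
    uCubic p q s x u = (u - (midpoint p q s T - δ : ℝ)) *
      (u - (midpoint p q s T + δ : ℝ)) * (u - (s + T : ℝ)) := by
  rw [uCubic_eq hT, show negDisc p q x T / 4 = -δ ^ 2 by linarith]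
  push_cast
  ring

/-- For `x > 0` with three real zeros, the two smaller ones have the same sign, and stay below the
third one in absolute value. -/
theorem IsBranch.sortedRoots_of_pos_of_neg_sq (hx : 0 < x) (hs : 0 < s) (hT : IsBranch p q x s T)
    {δ : ℝ} (hδ0 : 0 < δ) (hδ : δ ^ 2 = -negDisc p q x T / 4) :
    (0 < midpoint p q s T → 0 < midpoint p q s T - δ ∧
      IsSortedRoots p q s x (midpoint p q s T - δ : ℝ) (midpoint p q s T + δ : ℝ) (s + T : ℝ)) ∧
    (midpoint p q s T ≤ 0 → midpoint p q s T + δ < 0 ∧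
      IsSortedRoots p q s x (midpoint p q s T + δ : ℝ) (midpoint p q s T - δ : ℝ) (s + T : ℝ)) := by
  have hv := hT.add_pos hp hq hx.ne' hs
  have hP := rootProd_pos hp hq hs
  have hE := cubicDeriv_pos hp hq hx.ne' hs.le hT
  rw [← sub_midpoint_sq (s := s), show negDisc p q x T / 4 = -δ ^ 2 by linarith] at hE
  rw [← mul_midpoint_sq hT.1, show negDisc p q x T / 4 = -δ ^ 2 by linarith] at hP
  -- The product of the two side zeros is positive, so they have the same sign.
  have hA := pos_of_mul_pos_right hP hv.le
  have hT' := hT.2.1 hx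
  have hmid : midpoint p q s T < s + T := by unfold midpoint; linarith
  have hδv : δ < s + T - midpoint p q s T := by
    refine lt_of_pow_lt_pow_left₀ 2 (by linarith) (by linarith)
  constructor
  · intro hm
    have h1 : δ < midpoint p q s T := lt_of_pow_lt_pow_left₀ 2 hm.le (by linarith)
    refine ⟨by linarith, uCubic_eq_of_neg_sq hT.1 hδ, ?_, ?_⟩
    · rw [Complex.norm_real, Complex.norm_real, Real.norm_of_nonneg (by linarith),
        Real.norm_of_nonneg (by linarith)]
      linarith
    · rw [Complex.norm_real, Complex.norm_real, Real.norm_of_nonneg (by linarith),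
        Real.norm_of_nonneg (by linarith)]
      linarith
  · intro hm
    have h1 : δ < -midpoint p q s T := lt_of_pow_lt_pow_left₀ 2 (by linarith) (by linarith)
    refine ⟨by linarith, fun u => ?_, ?_, ?_⟩
    · rw [uCubic_eq_of_neg_sq hT.1 hδ]; ring
    · rw [Complex.norm_real, Complex.norm_real, Real.norm_of_nonpos (by linarith),
        Real.norm_of_nonpos (by linarith)]
      linarith
    · rw [Complex.norm_real, Complex.norm_real, Real.norm_of_nonpos (by linarith),
        Real.norm_of_nonneg (by linarith)]
      -- With `m` the midpoint, `|m - δ| < -2m = T - 2s - 2p - q < s + T`.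
      unfold midpoint at *
      linarith

theorem IsBranch.sortedRoots_of_neg_of_neg_sq (hx : x < 0) (hs : 0 < s) (hT : IsBranch p q x s T)
    {δ : ℝ} (hδ0 : 0 < δ) (hδ : δ ^ 2 = -negDisc p q x T / 4) :
    s + T < midpoint p q s T - δ ∧
      IsSortedRoots p q s x (s + T : ℝ) (midpoint p q s T - δ : ℝ) (midpoint p q s T + δ : ℝ) := by
  have hv := hT.add_pos hp hq hx.ne hs
  have hE := cubicDeriv_pos hp hq hx.ne hs.le hT
  rw [← sub_midpoint_sq (s := s), show negDisc p q x T / 4 = -δ ^ 2 by linarith] at hE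
  have hT' := hT.2.2 hx
  have hmid : s + T < midpoint p q s T := by unfold midpoint; linarith
  have hδv : δ < midpoint p q s T - (s + T) := by
    refine lt_of_pow_lt_pow_left₀ 2 (by linarith) (by linarith)
  refine ⟨by linarith, fun u => ?_, ?_, ?_⟩
  · rw [uCubic_eq_of_neg_sq hT.1 hδ]; ring
  · rw [Complex.norm_real, Complex.norm_real, Real.norm_of_nonneg (by linarith),
      Real.norm_of_nonneg (by linarith)]
    linarith
  · rw [Complex.norm_real, Complex.norm_real, Real.norm_of_nonneg (by linarith),
      Real.norm_of_nonneg (by linarith)]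
    linarith

omit hp hq in
theorem norm_sol_eq_iff (hP : 0 < rootProd p q s) {w : ℂ} {i j : Fin 3} :
    ‖sol p q s w i‖ = ‖sol p q s w j‖ ↔ ‖root p q s w i‖ = ‖root p q s w j‖ := by
  have h1 := norm_pos_iff.2 (sol_ne_zero hP w i)
  have h2 := norm_pos_iff.2 (sol_ne_zero hP w j)
  have h3 : (0 : ℝ) < ‖(rootProd p q s : ℂ)‖ :=
    norm_pos_iff.2 (by exact_mod_cast hP.ne')
  simp only [root, norm_div, norm_neg]
  rw [div_eq_div_iff h1.ne' h2.ne', mul_right_inj' h3.ne']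
  exact eq_comm

omit hp hq in
-- Only moduli enter, so any sorted list may replace the chosen one.
theorem logRatio_eq (hP : 0 < rootProd p q s) (j : Fin 2) {r : Fin 3 → ℂ}
    (hr : IsSortedRoots p q s x (r 0) (r 1) (r 2)) :
    logRatio p q j x s = Real.log ‖r j.succ‖ - Real.log ‖r j.castSucc‖ := by
  have h := hr.norm_eq hP (root_spec hP x)
  have hn : ∀ i : Fin 3, ‖r i‖ = ‖root p q s x i‖ := by
    intro i
    fin_cases i
    · exact h.1.symm
    · exact h.2.1.symm
    · exact h.2.2.symm
  have h0 : ‖root p q s x j.succ‖ ≠ 0 := norm_ne_zero_iff.2 (root_ne_zero hP _ _)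
  have h1 : ‖root p q s x j.castSucc‖ ≠ 0 := norm_ne_zero_iff.2 (root_ne_zero hP _ _)
  have h2 : ‖(rootProd p q s : ℂ)‖ ≠ 0 := norm_ne_zero_iff.2 (by exact_mod_cast hP.ne')
  rw [logRatio, hn, hn, ← Real.log_div h0 h1, sol_eq hP, sol_eq hP]
  congr 1
  simp only [norm_div, norm_neg]
  field_simp

omit hp hq in
theorem mem_Gam_iff (hP : 0 < rootProd p q s) (j : Fin 2) {r : Fin 3 → ℂ}
    (hr : IsSortedRoots p q s x (r 0) (r 1) (r 2)) :
    (x : ℂ) ∈ Gam p q s j ↔ ‖r j.castSucc‖ = ‖r j.succ‖ := by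
  have h := hr.norm_eq hP (root_spec hP x)
  have hn : ∀ i : Fin 3, ‖r i‖ = ‖root p q s x i‖ := by
    intro i
    fin_cases i
    · exact h.1.symm
    · exact h.2.1.symm
    · exact h.2.2.symm
  rw [hn, hn, ← norm_sol_eq_iff hP]
  rfl

omit hp hq in
theorem IsSortedRoots.mem_Gam_zero_iff (hP : 0 < rootProd p q s) {r₀ r₁ r₂ : ℂ}
    (hr : IsSortedRoots p q s x r₀ r₁ r₂) : (x : ℂ) ∈ Gam p q s 0 ↔ ‖r₀‖ = ‖r₁‖ :=
  mem_Gam_iff hP 0 (r := ![r₀, r₁, r₂]) hr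

omit hp hq in
theorem IsSortedRoots.mem_Gam_one_iff (hP : 0 < rootProd p q s) {r₀ r₁ r₂ : ℂ}
    (hr : IsSortedRoots p q s x r₀ r₁ r₂) : (x : ℂ) ∈ Gam p q s 1 ↔ ‖r₁‖ = ‖r₂‖ :=
  mem_Gam_iff hP 1 (r := ![r₀, r₁, r₂]) hr

omit hp hq in
theorem half_sqrt_sq {y : ℝ} (hy : 0 ≤ y) : (√y / 2) ^ 2 = y / 4 := by
  rw [div_pow, Real.sq_sqrt hy]; norm_num

/-- For `x > 0` the pair fills the two smaller places: conjugate (or merged) zeros have equal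
moduli, distinct real ones of the same sign do not. For `x ≤ 0` the smallest zero is strictly
separated from the others. -/
theorem mem_Gam_zero_iff (hs : 0 < s) :
    (x : ℂ) ∈ Gam p q s 0 ↔ 0 < x ∧ 0 ≤ negDisc p q x (branch p q x s) := by
  have hP := rootProd_pos hp hq hs
  rcases lt_trichotomy x 0 with hx | hx | hx
  · have hT := branch_spec hp hq hx.ne hs.le
    simp only [hx.not_gt, false_and, iff_false]
    by_cases hN : 0 ≤ negDisc p q x (branch p q x s)
    · have hr := hT.sortedRoots_of_neg hp hq hx hs (half_sqrt_sq hN)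
      rw [hr.mem_Gam_zero_iff hP]
      exact (hT.lt_norm hp hq hx hs (half_sqrt_sq hN)).ne
    · push Not at hN
      have hδ : 0 < √(-negDisc p q x (branch p q x s)) / 2 := by
        have := neg_pos.2 hN
        positivity
      obtain ⟨h1, hr⟩ := hT.sortedRoots_of_neg_of_neg_sq hp hq hx hs hδ
        (half_sqrt_sq (by linarith))
      rw [hr.mem_Gam_zero_iff hP]
      have hv := hT.add_pos hp hq hx.ne hs
      rw [Complex.norm_real, Complex.norm_real, Real.norm_of_nonneg hv.le,
        Real.norm_of_nonneg (by linarith)]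
      exact h1.ne
  · subst hx
    have hr : IsSortedRoots p q s ((0 : ℝ) : ℂ) (s : ℝ) (s + p : ℝ) (s + p + q : ℝ) := by
      refine ⟨fun u => by unfold uCubic; push_cast; ring, ?_, ?_⟩ <;>
      rw [Complex.norm_real, Complex.norm_real, Real.norm_of_nonneg (by positivity),
        Real.norm_of_nonneg (by positivity)] <;> linarith
    rw [hr.mem_Gam_zero_iff hP]
    rw [Complex.norm_real, Complex.norm_real, Real.norm_of_nonneg (by positivity),
        Real.norm_of_nonneg (by positivity)]
    simp [hp.ne']
  · have hT := branch_spec hp hq hx.ne' hs.le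
    simp only [hx, true_and]
    by_cases hN : 0 ≤ negDisc p q x (branch p q x s)
    · have hr := hT.sortedRoots_of_pos hp hq hx hs (half_sqrt_sq hN)
      rw [hr.mem_Gam_zero_iff hP]
      simp only [hN, iff_true]
      exact (norm_sub_eq_norm_add _ _).symm
    · simp only [hN, iff_false]
      push Not at hN
      have hδ : 0 < √(-negDisc p q x (branch p q x s)) / 2 := by
        have := neg_pos.2 hN
        positivity
      obtain ⟨h1, h2⟩ := hT.sortedRoots_of_pos_of_neg_sq hp hq hx hs hδ
        (half_sqrt_sq (by linarith))
      rcases lt_or_ge 0 (midpoint p q s (branch p q x s)) with hm | hm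
      · obtain ⟨h3, hr⟩ := h1 hm
        rw [hr.mem_Gam_zero_iff hP]
        rw [Complex.norm_real, Complex.norm_real, Real.norm_of_nonneg (by linarith),
          Real.norm_of_nonneg (by linarith)]
        linarith
      · obtain ⟨h3, hr⟩ := h2 hm
        rw [hr.mem_Gam_zero_iff hP]
        rw [Complex.norm_real, Complex.norm_real, Real.norm_of_nonpos (by linarith),
          Real.norm_of_nonpos (by linarith)]
        linarith

/-- For `x < 0` the pair fills the two larger places; for `x ≥ 0` the largest zero is strictly
separated. -/
theorem mem_Gam_one_iff (hs : 0 < s) :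
    (x : ℂ) ∈ Gam p q s 1 ↔ x < 0 ∧ 0 ≤ negDisc p q x (branch p q x s) := by
  have hP := rootProd_pos hp hq hs
  rcases lt_trichotomy x 0 with hx | hx | hx
  · have hT := branch_spec hp hq hx.ne hs.le
    simp only [hx, true_and]
    by_cases hN : 0 ≤ negDisc p q x (branch p q x s)
    · have hr := hT.sortedRoots_of_neg hp hq hx hs (half_sqrt_sq hN)
      rw [hr.mem_Gam_one_iff hP]
      simp only [hN, iff_true]
      exact (norm_sub_eq_norm_add _ _).symm
    · simp only [hN, iff_false]
      push Not at hN
      have hδ : 0 < √(-negDisc p q x (branch p q x s)) / 2 := by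
        have := neg_pos.2 hN
        positivity
      obtain ⟨h1, hr⟩ := hT.sortedRoots_of_neg_of_neg_sq hp hq hx hs hδ
        (half_sqrt_sq (by linarith))
      rw [hr.mem_Gam_one_iff hP]
      have hv := hT.add_pos hp hq hx.ne hs
      rw [Complex.norm_real, Complex.norm_real, Real.norm_of_nonneg (by linarith),
        Real.norm_of_nonneg (by linarith)]
      linarith
  · subst hx
    have hr : IsSortedRoots p q s ((0 : ℝ) : ℂ) (s : ℝ) (s + p : ℝ) (s + p + q : ℝ) := by
      refine ⟨fun u => by unfold uCubic; push_cast; ring, ?_, ?_⟩ <;>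
      rw [Complex.norm_real, Complex.norm_real, Real.norm_of_nonneg (by positivity),
        Real.norm_of_nonneg (by positivity)] <;> linarith
    rw [hr.mem_Gam_one_iff hP]
    rw [Complex.norm_real, Complex.norm_real, Real.norm_of_nonneg (by positivity),
        Real.norm_of_nonneg (by positivity)]
    simp [hq.ne']
  · have hT := branch_spec hp hq hx.ne' hs.le
    simp only [hx.not_gt, false_and, iff_false]
    by_cases hN : 0 ≤ negDisc p q x (branch p q x s)
    · have hr := hT.sortedRoots_of_pos hp hq hx hs (half_sqrt_sq hN)
      rw [hr.mem_Gam_one_iff hP]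
      have := hT.norm_lt hp hq hx hs (half_sqrt_sq hN)
      rw [← norm_sub_eq_norm_add] at this
      exact this.ne
    · push Not at hN
      have hδ : 0 < √(-negDisc p q x (branch p q x s)) / 2 := by
        have := neg_pos.2 hN
        positivity
      obtain ⟨h1, h2⟩ := hT.sortedRoots_of_pos_of_neg_sq hp hq hx hs hδ
        (half_sqrt_sq (by linarith))
      have hv := hT.add_pos hp hq hx.ne' hs
      have hE := cubicDeriv_pos hp hq hx.ne' hs.le hT
      have hT' := hT.2.1 hx
      set δ := √(-negDisc p q x (branch p q x s)) / 2 with hδd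
      have hδ2 : δ ^ 2 = -negDisc p q x (branch p q x s) / 4 :=
        half_sqrt_sq (by linarith)
      rw [← sub_midpoint_sq (s := s), show negDisc p q x (branch p q x s) / 4 = -δ ^ 2 by linarith]
        at hE
      have hmid : midpoint p q s (branch p q x s) < s + branch p q x s := by
        unfold midpoint; linarith
      have hδv : δ < s + branch p q x s - midpoint p q s (branch p q x s) :=
        lt_of_pow_lt_pow_left₀ 2 (by linarith) (by linarith)
      rcases lt_or_ge 0 (midpoint p q s (branch p q x s)) with hm | hm
      · obtain ⟨h3, hr⟩ := h1 hm
        rw [hr.mem_Gam_one_iff hP]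
        rw [Complex.norm_real, Complex.norm_real, Real.norm_of_nonneg (by linarith),
          Real.norm_of_nonneg (by linarith)]
        linarith
      · obtain ⟨h3, hr⟩ := h2 hm
        rw [hr.mem_Gam_one_iff hP]
        rw [Complex.norm_real, Complex.norm_real, Real.norm_of_nonpos (by linarith),
          Real.norm_of_nonneg (by linarith)]
        unfold midpoint at *
        linarith

end RealAxis

/-! ### Boundary values and the density of `μ_jˢ`. -/

section BoundaryValues

variable {p q s x : ℝ}

theorem tendsto_sol_of_root (hP : 0 < rootProd p q s) {l : Filter ℂ} {j : Fin 3} {U : ℂ}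
    (hU : U ≠ 0) (h : Tendsto (fun w => root p q s w j) l (𝓝 U)) :
    Tendsto (fun w => sol p q s w j) l (𝓝 (-(rootProd p q s : ℂ) / U)) := by
  simp_rw [sol_eq hP]
  exact tendsto_const_nhds.div h hU

theorem hasBoundaryValues_of_root (hP : 0 < rootProd p q s) {j : Fin 3} {U V : ℂ}
    (hU : U ≠ 0) (hV : V ≠ 0) (h : Tendsto (fun w => root p q s w j) (upperNhds x) (𝓝 U))
    (h' : Tendsto (fun w => root p q s w j) (lowerNhds x) (𝓝 V)) :
    HasBoundaryValues p q s j x ∧ solPlus p q s j x = -(rootProd p q s : ℂ) / U ∧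
      solMinus p q s j x = -(rootProd p q s : ℂ) / V := by
  have := upperNhds_neBot x
  have := lowerNhds_neBot x
  have h1 := tendsto_sol_of_root hP hU h
  have h2 := tendsto_sol_of_root hP hV h'
  have e1 : solPlus p q s j x = _ := h1.limUnder_eq
  have e2 : solMinus p q s j x = _ := h2.limUnder_eq
  exact ⟨⟨by rwa [e1], by rwa [e2]⟩, e1, e2⟩

theorem deriv_neg_div {φ : ℂ → ℂ} {w : ℂ} (c : ℂ) (h : DifferentiableAt ℂ φ w) (h0 : φ w ≠ 0) :
    deriv (fun w => -c / φ w) w = c * deriv φ w / φ w ^ 2 := by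
  have := (hasDerivAt_const w (-c)).fun_div h.hasDerivAt h0
  rw [this.deriv]
  ring

/-- Since `S` is open, equality with `φ` on `S` near `w` holds in full neighbourhoods of the points
of `S`, so derivatives agree there too. -/
theorem tendsto_deriv_sol_of_root (hP : 0 < rootProd p q s) {S : Set ℂ} (hS : IsOpen S) {j : Fin 3}
    {φ : ℂ → ℂ} {w : ℂ} (hφ : AnalyticAt ℂ φ w) (hφ0 : φ w ≠ 0)
    (h : ∀ᶠ y in 𝓝[S] w, root p q s y j = φ y) :
    Tendsto (deriv fun y => sol p q s y j) (𝓝[S] w)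
      (𝓝 ((rootProd p q s : ℂ) * deriv φ w / φ w ^ 2)) := by
  have hc : Tendsto (fun y => (rootProd p q s : ℂ) * deriv φ y / φ y ^ 2) (𝓝[S] w)
      (𝓝 ((rootProd p q s : ℂ) * deriv φ w / φ w ^ 2)) :=
    ((hφ.deriv.continuousAt.const_mul _).div (hφ.continuousAt.pow 2)
      (pow_ne_zero 2 hφ0)).tendsto.mono_left nhdsWithin_le_nhds
  refine hc.congr' ?_
  have h1 : ∀ᶠ y in 𝓝[S] w, AnalyticAt ℂ φ y := nhdsWithin_le_nhds hφ.eventually_analyticAt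
  have h2 : ∀ᶠ y in 𝓝[S] w, φ y ≠ 0 := nhdsWithin_le_nhds (hφ.continuousAt.eventually_ne hφ0)
  filter_upwards [h1, h2, self_mem_nhdsWithin, eventually_eventually_nhdsWithin.2 h]
    with y h1 h2 h3 h4
  rw [hS.nhdsWithin_eq h3] at h4
  rw [← deriv_neg_div _ h1.differentiableAt h2]
  refine Filter.EventuallyEq.deriv_eq ?_
  filter_upwards [h4] with z hz
  rw [sol_eq hP, hz]

theorem isOpen_im_pos : IsOpen {w : ℂ | 0 < w.im} := isOpen_lt continuous_const Complex.continuous_im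

theorem isOpen_im_neg : IsOpen {w : ℂ | w.im < 0} := isOpen_lt Complex.continuous_im continuous_const

theorem analyticAt_conj_conj {φ : ℂ → ℂ} (hφ : AnalyticAt ℂ φ x) :
    AnalyticAt ℂ (fun w => conj (φ (conj w))) x := by
  rw [Complex.analyticAt_iff_eventually_differentiableAt] at hφ ⊢
  have hconj : Tendsto (conj : ℂ → ℂ) (𝓝 (x : ℂ)) (𝓝 (x : ℂ)) := by
    have := Complex.continuous_conj.tendsto (x : ℂ)
    rwa [Complex.conj_ofReal] at this
  filter_upwards [hconj.eventually hφ] with w hw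
  have := hw.conj_conj
  rwa [Complex.conj_conj] at this

theorem boundary_of_analytic (hP : 0 < rootProd p q s) {j : Fin 3} {φ : ℂ → ℂ}
    (hφ : AnalyticAt ℂ φ x) (hφ0 : φ x ≠ 0)
    (hu : ∀ᶠ w in upperNhds x, root p q s w j = φ w)
    (hl : ∀ᶠ w in lowerNhds x, root p q s w j = conj (φ (conj w))) :
    HasBoundaryValues p q s j x ∧ solPlus p q s j x = -(rootProd p q s : ℂ) / φ x ∧
      solMinus p q s j x = -(rootProd p q s : ℂ) / conj (φ x) ∧
      derivSolPlus p q s j x / solPlus p q s j x = -(deriv φ x / φ x) ∧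
      derivSolMinus p q s j x / solMinus p q s j x = -conj (deriv φ x / φ x) := by
  have : (𝓝[{w : ℂ | 0 < w.im}] (x : ℂ)).NeBot := upperNhds_neBot x
  have : (𝓝[{w : ℂ | w.im < 0}] (x : ℂ)).NeBot := lowerNhds_neBot x
  have hR : (rootProd p q s : ℂ) ≠ 0 := by exact_mod_cast hP.ne'
  have hψ := analyticAt_conj_conj hφ
  have hψx : conj (φ (conj (x : ℂ))) = conj (φ x) := by rw [Complex.conj_ofReal]
  have hφ0' : conj (φ x) ≠ 0 := by simpa using hφ0
  have t1 : Tendsto (fun w => root p q s w j) (upperNhds x) (𝓝 (φ x)) :=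
    (hφ.continuousAt.tendsto.mono_left nhdsWithin_le_nhds).congr' (hu.mono fun _ h => h.symm)
  have t2 : Tendsto (fun w => root p q s w j) (lowerNhds x) (𝓝 (conj (φ x))) := by
    rw [← hψx]
    exact (hψ.continuousAt.tendsto.mono_left nhdsWithin_le_nhds).congr' (hl.mono fun _ h => h.symm)
  obtain ⟨h1, h2, h3⟩ := hasBoundaryValues_of_root hP hφ0 hφ0' t1 t2
  have d1 : derivSolPlus p q s j x = _ :=
    (tendsto_deriv_sol_of_root hP isOpen_im_pos hφ hφ0 hu).limUnder_eq
  have d2 : derivSolMinus p q s j x = _ :=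
    (tendsto_deriv_sol_of_root hP isOpen_im_neg hψ (by rwa [hψx]) hl).limUnder_eq
  have hd : deriv (fun w => conj (φ (conj w))) x = conj (deriv φ x) := by
    have := (hφ.differentiableAt.hasDerivAt).conj_conj
    rw [Complex.conj_ofReal] at this
    exact this.deriv
  rw [hd, hψx] at d2
  refine ⟨h1, h2, h3, ?_, ?_⟩
  · rw [d1, h2]; field_simp
  · rw [d2, h3, map_div₀]; field_simp

theorem muDensity_of_analytic {j : Fin 2} {d : ℂ}
    (h1 : derivSolPlus p q s j.castSucc x / solPlus p q s j.castSucc x = -d)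
    (h2 : derivSolMinus p q s j.castSucc x / solMinus p q s j.castSucc x = -conj d) :
    muDensity p q s j x = ((d.im / Real.pi : ℝ) : ℂ) := by
  rw [muDensity, h1, h2]
  have : -conj d - -d = 2 * d.im * Complex.I := by
    rw [sub_neg_eq_add, add_comm, ← sub_eq_add_neg, Complex.sub_conj]; push_cast; ring
  rw [this]
  have := Complex.I_ne_zero
  have : (Real.pi : ℂ) ≠ 0 := by exact_mod_cast Real.pi_ne_zero
  push_cast
  field_simp

/-- The density of `μ_jˢ` on the interior of `Γ_j(s)` in terms of the real branch. -/
def branchDensity (p q x s : ℝ) : ℝ :=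
  |3 * branch p q x s - (2 * p + q)| /
    (2 * Real.pi * √(negDisc p q x (branch p q x s)) * cubicDeriv p q x (branch p q x s))

variable (hp : 0 < p) (hq : 0 < q)
include hp hq

/-- The common part of the analysis at the interior points of `Γ₁(s)` and `Γ₂(s)`. -/
theorem boundary_of_pair (hx : x ≠ 0) (hs : 0 < s) {T ε : ℝ} (hT : IsBranch p q x s T)
    (hε : ε ^ 2 = negDisc p q x T / 4) (hεx : 0 < ε * x) {j : Fin 2}
    (hj : ∀ φ ψ χ : ℂ → ℂ, Tendsto φ (𝓝 (x : ℂ)) (𝓝 (midpoint p q s T + ε * Complex.I)) →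
      Tendsto ψ (𝓝 (x : ℂ)) (𝓝 (midpoint p q s T - ε * Complex.I)) →
      Tendsto χ (𝓝 (x : ℂ)) (𝓝 (s + T : ℝ)) →
      ∀ᶠ w in 𝓝 (x : ℂ), (∀ u, uCubic p q s w u = (u - φ w) * (u - ψ w) * (u - χ w)) →
        (‖φ w‖ < ‖ψ w‖ → root p q s w j.castSucc = φ w) ∧
        (‖ψ w‖ < ‖φ w‖ → root p q s w j.castSucc = ψ w)) :
    HasBoundaryValues p q s j.castSucc x ∧
      solPlus p q s j.castSucc x =
        -(rootProd p q s : ℂ) / (midpoint p q s T + ε * Complex.I) ∧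
      solMinus p q s j.castSucc x =
        -(rootProd p q s : ℂ) / (midpoint p q s T - ε * Complex.I) ∧
      muDensity p q s j x =
        (((3 * T - (2 * p + q)) / (4 * Real.pi * ε * cubicDeriv p q x T) : ℝ) : ℂ) := by
  have hP := rootProd_pos hp hq hs
  have hε0 : ε ≠ 0 := by rintro rfl; simp at hεx
  have hE := cubicDeriv_pos hp hq hx hs.le hT
  set U : ℂ := midpoint p q s T + ε * Complex.I with hUdef
  have hUre : U.re = midpoint p q s T := by simp [hUdef]
  have hUim : U.im = ε := by simp [hUdef]
  have hUc : conj U = midpoint p q s T - ε * Complex.I := by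
    simp [hUdef, sub_eq_add_neg]
  have hU0 : U ≠ 0 := by
    intro h
    rw [h] at hUim
    exact hε0 hUim.symm
  -- The sign of `ε` is that of `x`, hence that of `s + T - Re U`. This makes `φ` the smaller member
  -- of the pair in the upper half plane.
  have hmul : 0 < (s + T - U.re) * U.im := by
    rw [hUre, hUim]
    have h1 := hT.mul_pos hp hq hx
    have h2 : 0 < (x * (3 * T - (2 * p + q))) * (ε * x) := mul_pos h1 hεx
    have h3 : (x * (3 * T - (2 * p + q))) * (ε * x) = ((3 * T - (2 * p + q)) * ε) * x ^ 2 := by ring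
    rw [h3] at h2
    have := pos_of_mul_pos_left h2 (sq_nonneg x)
    unfold midpoint
    linarith
  obtain ⟨φ, hφ, hφx, hφd, hfac, hlt⟩ := exists_analytic_root (p := p) (q := q) (s := s) (x := x)
    (v := s + T) (U := U) (fun u => by rw [uCubic_eq_of_sq hT.1 hε, hUc]; ring) hmul
  have hψ := analyticAt_conj_conj hφ
  have hφt : Tendsto φ (𝓝 (x : ℂ)) (𝓝 U) := by
    have := hφ.continuousAt.tendsto
    rwa [hφx] at this
  have hψt : Tendsto (fun w => conj (φ (conj w))) (𝓝 (x : ℂ)) (𝓝 (conj U)) := by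
    have := hψ.continuousAt.tendsto
    rwa [Complex.conj_ofReal, hφx] at this
  have hχt : Tendsto (fun w => 3 * s + 2 * p + q - φ w - conj (φ (conj w))) (𝓝 (x : ℂ))
      (𝓝 ((s + T : ℝ) : ℂ)) := by
    have := (tendsto_const_nhds (x := (3 * s + 2 * p + q : ℂ))).sub hφt |>.sub hψt
    have e : (3 * s + 2 * p + q : ℂ) - U - conj U = ((s + T : ℝ) : ℂ) := by
      rw [hUc, hUdef]; unfold midpoint; push_cast; ring
    rwa [e] at this
  have hev := (hj φ _ _ hφt (by rw [← hUc]; exact hψt) hχt).and hfac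
  have hu : ∀ᶠ w in upperNhds x, root p q s w j.castSucc = φ w := by
    filter_upwards [nhdsWithin_le_nhds hev, hlt] with w h1 h2
    refine (h1.1 h1.2).1 ?_
    rwa [Complex.norm_conj]
  have hl : ∀ᶠ w in lowerNhds x, root p q s w j.castSucc = conj (φ (conj w)) := by
    filter_upwards [nhdsWithin_le_nhds hev, (tendsto_conj_lowerNhds x).eventually hlt] with w h1 h2
    refine (h1.1 h1.2).2 ?_
    rwa [Complex.norm_conj, ← Complex.conj_conj w, Complex.conj_conj (conj w)]
  obtain ⟨b1, b2, b3, b4, b5⟩ := boundary_of_analytic hP hφ (by rwa [hφx]) hu hl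
  rw [hφx] at b2 b3
  rw [hUc] at b3
  refine ⟨b1, b2, b3, ?_⟩
  rw [muDensity_of_analytic b4 b5, hφd, hφx]
  congr 1
  have hUv : U - (s + T : ℝ) ≠ 0 := by
    intro h
    have := congrArg Complex.im h
    rw [Complex.sub_im, hUim] at this
    simp at this
    exact hε0 this
  have hUU : U - conj U = ((2 * ε : ℝ) : ℂ) * Complex.I := by
    rw [Complex.sub_conj, hUim]
  have e : U / ((U - (s + T : ℝ)) * (U - conj U)) / U
      = (((2 * ε)⁻¹ : ℝ) : ℂ) * (-Complex.I * (U - (s + T : ℝ))⁻¹) := by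
    rw [hUU]
    have : (ε : ℂ) ≠ 0 := by exact_mod_cast hε0
    have := Complex.I_ne_zero
    push_cast at hUv ⊢
    field_simp
    simp
  have hn : Complex.normSq (U - (s + T : ℝ)) = cubicDeriv p q x T := by
    rw [Complex.normSq_apply, ← sub_midpoint_sq (s := s), ← hε]
    simp only [Complex.sub_re, Complex.sub_im, hUre, hUim, Complex.ofReal_re, Complex.ofReal_im]
    ring
  rw [e, Complex.im_ofReal_mul]
  have e2 : (-Complex.I * (U - (s + T : ℝ))⁻¹).im = (s + T - midpoint p q s T) / cubicDeriv p q x T := by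
    rw [neg_mul, Complex.neg_im, Complex.I_mul_im, Complex.inv_re, hn, Complex.sub_re, hUre,
      Complex.ofReal_re]
    ring
  rw [e2]
  have := Real.pi_ne_zero
  unfold midpoint
  field_simp
  ring

theorem boundary_zero_of_pos (hx : 0 < x) (hs : 0 < s) (hN : 0 < negDisc p q x (branch p q x s)) :
    HasBoundaryValues p q s 0 x ∧
      solPlus p q s 0 x = -(rootProd p q s : ℂ) / (midpoint p q s (branch p q x s) +
        ((√(negDisc p q x (branch p q x s)) / 2 : ℝ) : ℂ) * Complex.I) ∧
      solMinus p q s 0 x = -(rootProd p q s : ℂ) / (midpoint p q s (branch p q x s) -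
        ((√(negDisc p q x (branch p q x s)) / 2 : ℝ) : ℂ) * Complex.I) ∧
      muDensity p q s 0 x = (branchDensity p q x s : ℂ) := by
  have hP := rootProd_pos hp hq hs
  have hT := branch_spec hp hq hx.ne' hs.le
  have hε := half_sqrt_sq hN.le
  have hsq := Real.sqrt_pos.2 hN
  obtain ⟨h1, h2, h3, h4⟩ := boundary_of_pair hp hq hx.ne' hs hT hε (by positivity) (j := 0) (by
    intro φ ψ χ hφ hψ hχ
    have n := hT.norm_lt hp hq hx hs hε
    have n' := n
    rw [← norm_sub_eq_norm_add] at n'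
    filter_upwards [hφ.norm.eventually_lt hχ.norm n, hψ.norm.eventually_lt hχ.norm n']
      with w a b hfac
    refine ⟨fun hlt => ?_, fun hlt => ?_⟩
    · have hr : IsSortedRoots p q s w (φ w) (ψ w) (χ w) := ⟨hfac, hlt.le, b.le⟩
      exact (hr.eq_of_lt hP (root_spec hP w) hlt b).1
    · have hr : IsSortedRoots p q s w (ψ w) (φ w) (χ w) :=
        ⟨fun u => by rw [hfac]; ring, hlt.le, a.le⟩
      exact (hr.eq_of_lt hP (root_spec hP w) hlt a).1)
  refine ⟨h1, h2, h3, ?_⟩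
  rw [h4, branchDensity, abs_of_pos (pos_of_mul_pos_right (hT.mul_pos hp hq hx.ne') hx.le)]
  congr 2
  ring

theorem boundary_one_of_pos (hx : x < 0) (hs : 0 < s) (hN : 0 < negDisc p q x (branch p q x s)) :
    HasBoundaryValues p q s 1 x ∧
      solPlus p q s 1 x = -(rootProd p q s : ℂ) / (midpoint p q s (branch p q x s) -
        ((√(negDisc p q x (branch p q x s)) / 2 : ℝ) : ℂ) * Complex.I) ∧
      solMinus p q s 1 x = -(rootProd p q s : ℂ) / (midpoint p q s (branch p q x s) +
        ((√(negDisc p q x (branch p q x s)) / 2 : ℝ) : ℂ) * Complex.I) ∧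
      muDensity p q s 1 x = (branchDensity p q x s : ℂ) := by
  have hP := rootProd_pos hp hq hs
  have hT := branch_spec hp hq hx.ne hs.le
  have hε := half_sqrt_sq hN.le
  -- For `x < 0` one takes `ε` negative, which interchanges the `+` and `-` values compared with `x
  -- > 0`.
  rw [← neg_sq] at hε
  have hsq := Real.sqrt_pos.2 hN
  obtain ⟨h1, h2, h3, h4⟩ := boundary_of_pair hp hq hx.ne hs hT hε (by nlinarith) (j := 1) (by
    intro φ ψ χ hφ hψ hχ
    have n := hT.lt_norm hp hq hx hs hε
    have n' := n
    rw [← norm_sub_eq_norm_add] at n'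
    filter_upwards [hχ.norm.eventually_lt hφ.norm n, hχ.norm.eventually_lt hψ.norm n']
      with w a b hfac
    refine ⟨fun hlt => ?_, fun hlt => ?_⟩
    · have hr : IsSortedRoots p q s w (χ w) (φ w) (ψ w) :=
        ⟨fun u => by rw [hfac]; ring, a.le, hlt.le⟩
      exact (hr.eq_of_lt hP (root_spec hP w) a hlt).2.1
    · have hr : IsSortedRoots p q s w (χ w) (ψ w) (φ w) :=
        ⟨fun u => by rw [hfac]; ring, b.le, hlt.le⟩
      exact (hr.eq_of_lt hP (root_spec hP w) b hlt).2.1)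
  rw [Complex.ofReal_neg, neg_mul, ← sub_eq_add_neg] at h2
  rw [Complex.ofReal_neg, neg_mul, sub_neg_eq_add] at h3
  refine ⟨h1, h2, h3, ?_⟩
  rw [h4, branchDensity, abs_of_neg (by have := hT.mul_pos hp hq hx.ne; nlinarith)]
  congr 1
  have hE := cubicDeriv_pos hp hq hx.ne hs.le hT
  have := Real.pi_pos
  field_simp
  ring

/-- The case `negDisc = 0` is an endpoint of `Γ₁(s)`: the analytic description fails at the double
zero, but every sorted list has that zero in its first place, so `tendsto_root` applies. -/
theorem boundary_zero (hx : 0 < x) (hs : 0 < s) (hN : 0 ≤ negDisc p q x (branch p q x s)) :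
    HasBoundaryValues p q s 0 x ∧
      solPlus p q s 0 x = -(rootProd p q s : ℂ) / (midpoint p q s (branch p q x s) +
        ((√(negDisc p q x (branch p q x s)) / 2 : ℝ) : ℂ) * Complex.I) ∧
      solMinus p q s 0 x = -(rootProd p q s : ℂ) / (midpoint p q s (branch p q x s) -
        ((√(negDisc p q x (branch p q x s)) / 2 : ℝ) : ℂ) * Complex.I) := by
  rcases hN.eq_or_lt with hN | hN
  · have hP := rootProd_pos hp hq hs
    have hT := branch_spec hp hq hx.ne' hs.le
    have hε := half_sqrt_sq hN.le
    have hr := hT.sortedRoots_of_pos hp hq hx hs hε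
    have hlt := hT.norm_lt hp hq hx hs hε
    rw [← hN] at hr hlt ⊢
    simp only [Real.sqrt_zero, zero_div, Complex.ofReal_zero, zero_mul, add_zero, sub_zero]
      at hr hlt ⊢
    have h0 : (midpoint p q s (branch p q x s) : ℂ) ≠ 0 := by
      intro h
      have := hr.prod
      rw [h] at this
      simp at this
      exact hP.ne (by exact_mod_cast this)
    have ht := tendsto_root hp hq hs (j := 0) (R := midpoint p q s (branch p q x s)) (x := x) (by
      intro r h
      obtain ⟨a0, -, -⟩ := hr.eq_or h
      have hn := (hr.norm_eq hP h).1
      rcases a0 with a | a | a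
      · exact a
      · exact a
      · rw [a] at hn
        exact absurd hn hlt.ne')
    exact hasBoundaryValues_of_root hP h0 h0 (ht.mono_left nhdsWithin_le_nhds)
      (ht.mono_left nhdsWithin_le_nhds)
  · obtain ⟨h1, h2, h3, -⟩ := boundary_zero_of_pos hp hq hx hs hN
    exact ⟨h1, h2, h3⟩

theorem boundary_one (hx : x < 0) (hs : 0 < s) (hN : 0 ≤ negDisc p q x (branch p q x s)) :
    HasBoundaryValues p q s 1 x ∧
      solPlus p q s 1 x = -(rootProd p q s : ℂ) / (midpoint p q s (branch p q x s) -
        ((√(negDisc p q x (branch p q x s)) / 2 : ℝ) : ℂ) * Complex.I) ∧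
      solMinus p q s 1 x = -(rootProd p q s : ℂ) / (midpoint p q s (branch p q x s) +
        ((√(negDisc p q x (branch p q x s)) / 2 : ℝ) : ℂ) * Complex.I) := by
  rcases hN.eq_or_lt with hN | hN
  · have hP := rootProd_pos hp hq hs
    have hT := branch_spec hp hq hx.ne hs.le
    have hε := half_sqrt_sq hN.le
    have hr := hT.sortedRoots_of_neg hp hq hx hs hε
    have hlt := hT.lt_norm hp hq hx hs hε
    rw [← hN] at hr hlt ⊢
    simp only [Real.sqrt_zero, zero_div, Complex.ofReal_zero, zero_mul, add_zero, sub_zero]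
      at hr hlt ⊢
    have h0 : (midpoint p q s (branch p q x s) : ℂ) ≠ 0 := by
      intro h
      have := hr.prod
      rw [h] at this
      simp at this
      exact hP.ne (by exact_mod_cast this)
    have ht := tendsto_root hp hq hs (j := 1) (R := midpoint p q s (branch p q x s)) (x := x) (by
      intro r h
      obtain ⟨-, a1, -⟩ := hr.eq_or h
      have hn := (hr.norm_eq hP h).2.1
      rcases a1 with a | a | a
      · rw [a] at hn
        exact absurd hn hlt.ne
      · exact a
      · exact a)
    exact hasBoundaryValues_of_root hP h0 h0 (ht.mono_left nhdsWithin_le_nhds)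
      (ht.mono_left nhdsWithin_le_nhds)
  · obtain ⟨h1, h2, h3, -⟩ := boundary_one_of_pos hp hq hx hs hN
    exact ⟨h1, h2, h3⟩

end BoundaryValues

/-! ### External fields. -/

theorem integrableOn_and_setIntegral_of_deriv_nonneg {f g : ℝ → ℝ} {a b : ℝ} (hab : a ≤ b)
    (hc : ContinuousOn g (Icc a b)) (hd : ∀ x ∈ Ioo a b, HasDerivAt g (f x) x)
    (hf : ∀ x ∈ Ioo a b, 0 ≤ f x) :
    IntegrableOn f (Ioc a b) ∧ ∫ x in Ioc a b, f x = g b - g a := by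
  -- The sign of `f` gives integrability without any bound near the endpoints, where `f` may blow
  -- up.
  have h := intervalIntegral.integrableOn_deriv_of_nonneg hc hd hf
  refine ⟨h, ?_⟩
  rw [← intervalIntegral.integral_of_le hab]
  exact intervalIntegral.integral_eq_sub_of_hasDerivAt_of_le hab hc hd
    ((intervalIntegrable_iff_integrableOn_Ioc_of_le hab).2 h)

/-- With `s = t (t - p) (t - p - q) / x - t`, a primitive of `s ↦ log |s + t|` as a function
of `t`. -/
def logPrimitive (p q x t : ℝ) : ℝ :=
  ((t - p) * (t - p - q) - x) / x * (t * Real.log t) +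
    t * ((t - p) * (t - p - q) - x) / x * Real.log ((t - p) * (t - p - q) / x) -
    t * (t - p) * (t - p - q) / x + 3 * t + p * Real.log (t - p) +
    (p + q) * Real.log (t - p - q)

/-- The two zeros of `realCubic` other than the real branch, where these are real
(`e = 1` and `e = -1`). -/
def sideRoot (p q x e s : ℝ) : ℝ :=
  (2 * p + q - branch p q x s) / 2 + e * (√(-negDisc p q x (branch p q x s)) / 2)

section ExternalField

variable {p q x : ℝ}

/-- The factor `cubicDeriv / x` is `ds/dt`, and the argument of the logarithm is `s + t` rewritten
by the equation. -/
theorem hasDerivAt_logPrimitive {t : ℝ} (hx : x ≠ 0) (h0 : t ≠ 0) (h1 : t - p ≠ 0)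
    (h2 : t - p - q ≠ 0) :
    HasDerivAt (logPrimitive p q x)
      (cubicDeriv p q x t / x * Real.log (t * (t - p) * (t - p - q) / x)) t := by
  have d := hasDerivAt_id t
  have dp := d.sub_const p
  have dq := dp.sub_const q
  have dK := dp.mul dq
  have hK : (t - p) * (t - p - q) / x ≠ 0 := div_ne_zero (mul_ne_zero h1 h2) hx
  have key := ((((((dK.sub_const x).div_const x).mul (d.mul (d.log h0))).add
    (((d.mul (dK.sub_const x)).div_const x).mul ((dK.div_const x).log hK))).sub
    (((d.mul dp).mul dq).div_const x)).add (d.const_mul 3)).add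
    ((dp.log h1).const_mul p) |>.add ((dq.log h2).const_mul (p + q))
  convert! key using 1
  have e : Real.log (t * (t - p) * (t - p - q) / x) =
      Real.log t + Real.log ((t - p) * (t - p - q) / x) := by
    rw [← Real.log_mul h0 hK]; congr 1; ring
  rw [e]
  simp only [id, Pi.mul_apply, cubicDeriv]
  field_simp
  ring

/-- The point `t = 0` is included, because `log t` occurs only in `t log t`; for `x > 0` it is a
side zero at `s = 0`. -/
theorem continuousOn_logPrimitive (hx : x ≠ 0) :
    ContinuousOn (logPrimitive p q x) {t | t - p ≠ 0 ∧ t - p - q ≠ 0} := by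
  unfold logPrimitive
  have h1 : ContinuousOn (fun t : ℝ => t * Real.log t) {t | t - p ≠ 0 ∧ t - p - q ≠ 0} :=
    Real.continuous_mul_log.continuousOn
  have h2 : ContinuousOn (fun t : ℝ => Real.log ((t - p) * (t - p - q) / x))
      {t | t - p ≠ 0 ∧ t - p - q ≠ 0} :=
    ContinuousOn.log (by fun_prop) fun t ht => div_ne_zero (mul_ne_zero ht.1 ht.2) hx
  have h3 : ContinuousOn (fun t : ℝ => Real.log (t - p)) {t | t - p ≠ 0 ∧ t - p - q ≠ 0} :=
    ContinuousOn.log (by fun_prop) fun t ht => ht.1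
  have h4 : ContinuousOn (fun t : ℝ => Real.log (t - p - q)) {t | t - p ≠ 0 ∧ t - p - q ≠ 0} :=
    ContinuousOn.log (by fun_prop) fun t ht => ht.2
  fun_prop

theorem logRatio_nonneg (hp : 0 < p) (hq : 0 < q) (j : Fin 2) {s : ℝ} (hs : 0 < s) :
    0 ≤ logRatio p q j x s := by
  have hP := rootProd_pos hp hq hs
  refine Real.log_nonneg ?_
  rw [norm_div, one_le_div (norm_pos_iff.2 (sol_ne_zero hP _ _))]
  obtain ⟨-, h1, h2⟩ := sol_spec p q s x
  fin_cases j
  · exact h1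
  · exact h2

theorem IsSortedRoots.logRatio_zero_eq {s r₀ r₁ r₂ : ℝ} (hP : 0 < rootProd p q s)
    (hr : IsSortedRoots p q s x r₀ r₁ r₂) : logRatio p q 0 x s = Real.log r₁ - Real.log r₀ := by
  have h : logRatio p q 0 x s = Real.log ‖(r₁ : ℂ)‖ - Real.log ‖(r₀ : ℂ)‖ :=
    logRatio_eq hP 0 (r := ![r₀, r₁, r₂]) hr
  rw [h, Complex.norm_real, Complex.norm_real, Real.norm_eq_abs, Real.norm_eq_abs, Real.log_abs,
    Real.log_abs]

theorem IsSortedRoots.logRatio_one_eq {s r₀ r₁ r₂ : ℝ} (hP : 0 < rootProd p q s)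
    (hr : IsSortedRoots p q s x r₀ r₁ r₂) : logRatio p q 1 x s = Real.log r₂ - Real.log r₁ := by
  have h : logRatio p q 1 x s = Real.log ‖(r₂ : ℂ)‖ - Real.log ‖(r₁ : ℂ)‖ :=
    logRatio_eq hP 1 (r := ![r₀, r₁, r₂]) hr
  rw [h, Complex.norm_real, Complex.norm_real, Real.norm_eq_abs, Real.norm_eq_abs, Real.log_abs,
    Real.log_abs]

theorem add_sideRoot (e s : ℝ) : s + sideRoot p q x e s =
    midpoint p q s (branch p q x s) + e * (√(-negDisc p q x (branch p q x s)) / 2) := by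
  unfold sideRoot midpoint; ring

theorem logPrimitive_zero : logPrimitive p q x 0 =
    p * Real.log p + (p + q) * Real.log (p + q) := by
  unfold logPrimitive
  rw [zero_sub, ← neg_add', Real.log_neg_eq_log, Real.log_neg_eq_log]
  ring

/-- Here `(t - p) (t - p - q) = x`, so the first two terms of the primitive vanish. `R` may be
either square root. -/
theorem logPrimitive_of_sq (hx : x ≠ 0) {R : ℝ} (hR : R ^ 2 = q ^ 2 + 4 * x) :
    logPrimitive p q x ((2 * p + q - R) / 2) = 2 * p + q - R + p * Real.log ((q - R) / 2) +
      (p + q) * Real.log ((q + R) / 2) := by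
  have h1 : (2 * p + q - R) / 2 - p = (q - R) / 2 := by ring
  have h2 : (2 * p + q - R) / 2 - p - q = -((q + R) / 2) := by ring
  have h3 : (q - R) / 2 * -((q + R) / 2) = x := by linear_combination hR / 4
  unfold logPrimitive
  rw [mul_assoc ((2 * p + q - R) / 2), h2, h1, h3, Real.log_neg_eq_log]
  field_simp
  ring

variable (hp : 0 < p) (hq : 0 < q)
include hp hq

theorem sideRoot_spec {s e : ℝ} (hx : x ≠ 0) (hs : 0 ≤ s) (he : e ^ 2 = 1)
    (hN : negDisc p q x (branch p q x s) ≤ 0) :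
    realCubic p q x s (sideRoot p q x e s) = 0 := by
  have h0 := (branch_spec hp hq hx hs).1
  have hsq := half_sqrt_sq (neg_nonneg.2 hN)
  set T := branch p q x s with hT
  set d := √(-negDisc p q x T) / 2 with hd
  have e1 : sideRoot p q x e s = (2 * p + q - T) / 2 + e * d := rfl
  rw [e1]
  unfold realCubic negDisc at *
  linear_combination h0 + ((2 * p + q - T) / 2 + e * d - T) * (hsq * e ^ 2 + he *
    (-(3 * T ^ 2 - 2 * (2 * p + q) * T - q ^ 2 - 4 * x) / 4))

/-- The derivative is the product of the differences to the other two zeros; a side zero cannot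
equal `T`, which is simple. -/
theorem cubicDeriv_sideRoot_ne_zero {s e : ℝ} (hx : x ≠ 0) (hs : 0 ≤ s) (he : e ^ 2 = 1)
    (hN : negDisc p q x (branch p q x s) < 0) :
    cubicDeriv p q x (sideRoot p q x e s) ≠ 0 := by
  have hE := cubicDeriv_pos hp hq hx hs (branch_spec hp hq hx hs)
  have hsq := half_sqrt_sq (neg_nonneg.2 hN.le)
  have hpos : 0 < √(-negDisc p q x (branch p q x s)) / 2 := by
    have := neg_pos.2 hN
    positivity
  set T := branch p q x s with hT
  set d := √(-negDisc p q x T) / 2 with hd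
  have e1 : sideRoot p q x e s = (2 * p + q - T) / 2 + e * d := rfl
  have e2 : cubicDeriv p q x (sideRoot p q x e s) =
      ((2 * p + q - T) / 2 + e * d - T) * (2 * (e * d)) := by
    rw [e1]
    unfold cubicDeriv negDisc at *
    linear_combination hsq * e ^ 2 + he * (-(3 * T ^ 2 - 2 * (2 * p + q) * T - q ^ 2 - 4 * x) / 4)
  have he0 : e ≠ 0 := by rintro rfl; norm_num at he
  rw [e2]
  refine mul_ne_zero (fun h => ?_) (by positivity)
  have h2 : (T - (2 * p + q - T) / 2) ^ 2 = d ^ 2 := by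
    have : T - (2 * p + q - T) / 2 = e * d := by linarith
    rw [this, mul_pow, he, one_mul]
  unfold cubicDeriv negDisc at *
  nlinarith

theorem sideRoot_ne {s e : ℝ} (hx : x ≠ 0) (hs : 0 ≤ s) (he : e ^ 2 = 1)
    (hN : negDisc p q x (branch p q x s) ≤ 0) :
    sideRoot p q x e s - p ≠ 0 ∧ sideRoot p q x e s - p - q ≠ 0 := by
  have h := sideRoot_spec hp hq hx hs he hN
  unfold realCubic at h
  constructor
  · intro h'
    rw [h', mul_zero, zero_mul, zero_sub, neg_eq_zero, mul_eq_zero] at h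
    have := h.resolve_left hx
    linarith
  · intro h'
    rw [h', mul_zero, zero_sub, neg_eq_zero, mul_eq_zero] at h
    have := h.resolve_left hx
    linarith

theorem continuousOn_sideRoot (hx : x ≠ 0) (e : ℝ) : ContinuousOn (sideRoot p q x e) (Ici 0) := by
  have h := continuousOn_branch_right hp hq hx
  unfold sideRoot negDisc
  fun_prop

theorem continuousOn_negDisc_branch (hx : x ≠ 0) :
    ContinuousOn (fun s => negDisc p q x (branch p q x s)) (Ici 0) := by
  have h := continuousOn_branch_right hp hq hx
  unfold negDisc
  fun_prop

theorem add_sideRoot_ne_zero {s e : ℝ} (hx : x ≠ 0) (hs : 0 < s) (he : e ^ 2 = 1)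
    (hN : negDisc p q x (branch p q x s) ≤ 0) : s + sideRoot p q x e s ≠ 0 := by
  have hP := rootProd_pos hp hq hs
  have hsq := half_sqrt_sq (neg_nonneg.2 hN)
  rw [← mul_midpoint_sq (branch_spec hp hq hx hs.le).1] at hP
  rw [add_sideRoot]
  intro h
  have h1 : midpoint p q s (branch p q x s) ^ 2 =
      (√(-negDisc p q x (branch p q x s)) / 2) ^ 2 := by
    rw [eq_neg_of_add_eq_zero_left h, neg_sq, mul_pow, he, one_mul]
  rw [h1, hsq] at hP
  simp [neg_div] at hP

/-- Chain rule: `dt/ds = x / cubicDeriv` cancels the weight in `hasDerivAt_logPrimitive`. `Real.log`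
is `log |·|`, so the sign of `s + t` is irrelevant. -/
theorem hasDerivAt_logPrimitive_sideRoot {s e : ℝ} (hx : x ≠ 0) (hs : 0 < s) (he : e ^ 2 = 1)
    (hN : negDisc p q x (branch p q x s) < 0) :
    HasDerivAt (fun r => logPrimitive p q x (sideRoot p q x e r))
      (Real.log (s + sideRoot p q x e s)) s := by
  have h := sideRoot_spec hp hq hx hs.le he hN.le
  have hne := sideRoot_ne hp hq hx hs.le he hN.le
  have h0 := add_sideRoot_ne_zero hp hq hx hs he hN.le
  have hE := cubicDeriv_sideRoot_ne_zero hp hq hx hs.le he hN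
  have ht0 : sideRoot p q x e s ≠ 0 := by
    intro h'
    rw [h'] at h h0
    unfold realCubic at h
    simp only [zero_mul, zero_sub, neg_eq_zero, mul_eq_zero] at h
    exact h0 (h.resolve_left hx)
  have hcN := (continuousOn_negDisc_branch hp hq hx).continuousAt (Ici_mem_nhds hs)
  have hd : HasDerivAt (sideRoot p q x e) (x / cubicDeriv p q x (sideRoot p q x e s)) s := by
    refine hasDerivAt_of_realCubic hx
      ((continuousOn_sideRoot hp hq hx e).continuousAt (Ici_mem_nhds hs)) ?_ hE
    filter_upwards [lt_mem_nhds hs, hcN.eventually (gt_mem_nhds hN)] with r hr hr'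
    exact sideRoot_spec hp hq hx hr.le he hr'.le
  have := (hasDerivAt_logPrimitive hx ht0 hne.1 hne.2).comp s hd
  convert! this using 1
  have e1 : sideRoot p q x e s * (sideRoot p q x e s - p) * (sideRoot p q x e s - p - q) / x
      = s + sideRoot p q x e s := by
    unfold realCubic at h
    field_simp
    linear_combination h
  rw [e1]
  field_simp

/-- The value of `s` from which on the two other zeros are not real. -/
theorem exists_threshold (hx : x ≠ 0) : ∃ s₀ ≥ 0, 0 ≤ negDisc p q x (branch p q x s₀) ∧
    (∀ s, 0 ≤ s → s < s₀ → negDisc p q x (branch p q x s) < 0) ∧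
    (∀ s, s₀ < s → 0 < negDisc p q x (branch p q x s)) ∧
    (0 < s₀ → negDisc p q x (branch p q x s₀) = 0) := by
  have hm := negDisc_branch_strictMonoOn hp hq hx
  rcases le_or_gt 0 (negDisc p q x (branch p q x 0)) with h | h
  · refine ⟨0, le_rfl, h, fun s h1 h2 => absurd h2 (not_lt.2 h1), fun s hs => ?_,
      fun h => absurd h (lt_irrefl _)⟩
    exact h.trans_lt (hm (mem_Ici.2 le_rfl) (mem_Ici.2 hs.le) hs)
  · obtain ⟨s₁, hs₁, h₁⟩ := exists_negDisc_branch_pos hp hq hx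
    obtain ⟨s₀, hs₀, h₀⟩ := intermediate_value_Icc hs₁
      ((continuousOn_negDisc_branch hp hq hx).mono Icc_subset_Ici_self)
      (show (0 : ℝ) ∈ Icc _ _ from ⟨h.le, h₁.le⟩)
    simp only at h₀
    refine ⟨s₀, hs₀.1, h₀.ge, fun s h1 h2 => ?_, fun s hs => ?_, fun _ => h₀⟩
    · rw [← h₀]; exact hm (mem_Ici.2 h1) (mem_Ici.2 hs₀.1) h2
    · rw [← h₀]; exact hm (mem_Ici.2 hs₀.1) (mem_Ici.2 (hs₀.1.trans hs.le)) hs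

/-- The sign `c` records which side zero has the larger modulus. The integrand vanishes after the
threshold, and at the threshold the two primitives cancel. -/
theorem integral_logRatio (hx : x ≠ 0) (j : Fin 2) (c : ℝ)
    (h0 : ∀ s > 0, 0 ≤ negDisc p q x (branch p q x s) → logRatio p q j x s = 0)
    (hc : ∀ s > 0, negDisc p q x (branch p q x s) < 0 → logRatio p q j x s =
      c * (Real.log (s + sideRoot p q x 1 s) - Real.log (s + sideRoot p q x (-1) s))) :
    IntegrableOn (logRatio p q j x) (Ioi 0) ∧ extField p q j x =
      c * (logPrimitive p q x (sideRoot p q x (-1) 0) -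
        logPrimitive p q x (sideRoot p q x 1 0)) := by
  obtain ⟨s₀, hs₀, hN₀, hlt, hgt, hN0⟩ := exists_threshold hp hq hx
  have hcont : ∀ e : ℝ, e ^ 2 = 1 →
      ContinuousOn (fun r => logPrimitive p q x (sideRoot p q x e r)) (Icc 0 s₀) := by
    intro e he
    rcases hs₀.eq_or_lt with h | h
    · rw [← h, Icc_self]; exact continuousOn_singleton _ _
    · refine (continuousOn_logPrimitive hx).comp
        ((continuousOn_sideRoot hp hq hx e).mono Icc_subset_Ici_self) fun s hs => ?_
      refine sideRoot_ne hp hq hx hs.1 he ?_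
      rcases hs.2.eq_or_lt with h' | h'
      · rw [h', hN0 h]
      · exact (hlt s hs.1 h').le
  obtain ⟨i1, i2⟩ := integrableOn_and_setIntegral_of_deriv_nonneg (f := logRatio p q j x)
    (g := fun r => c * (logPrimitive p q x (sideRoot p q x 1 r) -
      logPrimitive p q x (sideRoot p q x (-1) r))) hs₀
    (continuousOn_const.mul ((hcont 1 (by norm_num)).sub (hcont (-1) (by norm_num))))
    (fun s hs => by
      rw [hc s hs.1 (hlt s hs.1.le hs.2)]
      exact ((hasDerivAt_logPrimitive_sideRoot hp hq hx hs.1 (by norm_num)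
        (hlt s hs.1.le hs.2)).sub (hasDerivAt_logPrimitive_sideRoot hp hq hx hs.1 (by norm_num)
        (hlt s hs.1.le hs.2))).const_mul c)
    (fun s hs => logRatio_nonneg hp hq j hs.1)
  have hz : EqOn (logRatio p q j x) (fun _ => 0) (Ioi s₀) := fun s hs =>
    h0 s (hs₀.trans_lt hs) (hgt s hs).le
  have i3 : IntegrableOn (logRatio p q j x) (Ioi s₀) :=
    (integrableOn_congr_fun hz measurableSet_Ioi).2 integrableOn_zero
  have hu : Ioi (0 : ℝ) = Ioc 0 s₀ ∪ Ioi s₀ := (Ioc_union_Ioi_eq_Ioi hs₀).symm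
  refine ⟨by rw [hu]; exact i1.union i3, ?_⟩
  rw [extField, hu, setIntegral_union (Ioc_disjoint_Ioi le_rfl) measurableSet_Ioi i1 i3, i2,
    setIntegral_congr_fun measurableSet_Ioi hz, integral_zero, add_zero]
  -- `√` of a nonpositive number is `0`; this covers the case `s₀ = 0` with `negDisc > 0` as well.
  have : ∀ e, sideRoot p q x e s₀ = (2 * p + q - branch p q x s₀) / 2 := by
    intro e
    rw [sideRoot, Real.sqrt_eq_zero_of_nonpos (by linarith)]
    ring
  rw [this, this]
  ring

theorem logRatio_eq_zero {s : ℝ} (hs : 0 < s) {j : Fin 2}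
    (hj : (x : ℂ) ∈ Gam p q s j) : logRatio p q j x s = 0 := by
  have hP := rootProd_pos hp hq hs
  have hj : ‖sol p q s x j.castSucc‖ = ‖sol p q s x j.succ‖ := hj
  rw [logRatio, norm_div, hj, div_self (norm_ne_zero_iff.2 (sol_ne_zero hP _ _)), Real.log_one]

theorem branch_zero_of_pos (hx : 0 < x) :
    branch p q x 0 = (2 * p + q + √(q ^ 2 + 4 * x)) / 2 := by
  have hR : √(q ^ 2 + 4 * x) ^ 2 = q ^ 2 + 4 * x := Real.sq_sqrt (by positivity)
  have hqR : q < √(q ^ 2 + 4 * x) := Real.lt_sqrt_of_sq_lt (by linarith)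
  refine IsBranch.eq_branch hp hq hx.ne' le_rfl ⟨?_, fun _ => by linarith,
    fun h => absurd h (by linarith)⟩
  unfold realCubic
  linear_combination ((2 * p + q + √(q ^ 2 + 4 * x)) / 8) * hR

theorem branch_zero_of_neg (hx : x < 0) : branch p q x 0 = 0 :=
  IsBranch.eq_branch hp hq hx.ne le_rfl ⟨by unfold realCubic; ring, fun h => absurd h (by linarith),
    fun _ => le_rfl⟩

theorem negDisc_branch_zero_of_pos (hx : 0 < x) : negDisc p q x (branch p q x 0) =
    -((2 * p + q - √(q ^ 2 + 4 * x)) / 2) ^ 2 := by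
  have hR : √(q ^ 2 + 4 * x) ^ 2 = q ^ 2 + 4 * x := Real.sq_sqrt (by positivity)
  rw [branch_zero_of_pos hp hq hx]
  unfold negDisc
  linear_combination hR

theorem negDisc_branch_zero_of_neg (hx : x < 0) : negDisc p q x (branch p q x 0) =
    -(q ^ 2 + 4 * x) := by
  rw [branch_zero_of_neg hp hq hx]
  unfold negDisc
  ring

theorem extField_zero (hx : 0 < x) :
    IntegrableOn (logRatio p q 0 x) (Ioi 0) ∧
      extField p q 0 x =
        √(q ^ 2 + 4 * x) - p * Real.log (4 * x) - q * Real.log (√(q ^ 2 + 4 * x) + q)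
          - 2 * p - q + p * Real.log (4 * p ^ 2 + 4 * p * q) + q * Real.log (2 * p + 2 * q) := by
  set R := √(q ^ 2 + 4 * x) with hRdef
  have hR : R ^ 2 = q ^ 2 + 4 * x := Real.sq_sqrt (by positivity)
  have hqR : q < R := Real.lt_sqrt_of_sq_lt (by linarith)
  have hgam : ∀ s > 0, 0 ≤ negDisc p q x (branch p q x s) → logRatio p q 0 x s = 0 :=
    fun s hs h => logRatio_eq_zero hp hq hs ((mem_Gam_zero_iff hp hq hs).2 ⟨hx, h⟩)
  have hside : ∀ e, sideRoot p q x e 0 = (2 * p + q - R) / 4 + e * (|2 * p + q - R| / 4) := by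
    intro e
    rw [sideRoot, negDisc_branch_zero_of_pos hp hq hx, neg_neg, Real.sqrt_sq_eq_abs,
      branch_zero_of_pos hp hq hx, abs_div, abs_two]
    ring
  have hlog : logPrimitive p q x 0 - logPrimitive p q x ((2 * p + q - R) / 2) =
      R - p * Real.log (4 * x) - q * Real.log (R + q)
          - 2 * p - q + p * Real.log (4 * p ^ 2 + 4 * p * q) + q * Real.log (2 * p + 2 * q) := by
    rw [logPrimitive_zero, logPrimitive_of_sq hx.ne' hR]
    have e1 : Real.log (4 * x) = Real.log (R - q) + Real.log (R + q) := by
      rw [← Real.log_mul (by linarith) (by linarith)]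
      congr 1
      linear_combination -hR
    have e2 : Real.log (4 * p ^ 2 + 4 * p * q) = 2 * Real.log 2 + Real.log p + Real.log (p + q) := by
      rw [show 4 * p ^ 2 + 4 * p * q = 2 ^ 2 * p * (p + q) by ring,
        Real.log_mul (by positivity) (by positivity), Real.log_mul (by positivity) (by positivity),
        Real.log_pow]
      norm_num
    have e3 : Real.log (2 * p + 2 * q) = Real.log 2 + Real.log (p + q) := by
      rw [← Real.log_mul (by norm_num) (by positivity)]; congr 1; ring
    have e4 : Real.log ((q - R) / 2) = Real.log (R - q) - Real.log 2 := by
      rw [← Real.log_neg_eq_log, ← Real.log_div (by linarith) (by norm_num)]; congr 1; ring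
    have e5 : Real.log ((q + R) / 2) = Real.log (R + q) - Real.log 2 := by
      rw [← Real.log_div (by linarith) (by norm_num)]; congr 1; ring
    rw [e1, e2, e3, e4, e5]
    ring
  -- At `x = p (p + q)` the quantity `2p + q - R` changes sign. Below, the two small zeros are
  -- positive; above, they are negative and their order by modulus is reversed. The absolute value
  -- in `hside` compensates.
  rcases lt_or_ge x (p * (p + q)) with hxm | hxm
  · have hRk : R < 2 * p + q := by
      refine lt_of_pow_lt_pow_left₀ 2 (by positivity) ?_
      nlinarith
    obtain ⟨h1, h2⟩ := integral_logRatio hp hq hx.ne' 0 1 hgam (by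
      intro s hs hN
      have hT := branch_spec hp hq hx.ne' hs.le
      have hδ : 0 < √(-negDisc p q x (branch p q x s)) / 2 := by
        have := neg_pos.2 hN
        positivity
      -- `T ≥ 2p + q` would give `negDisc ≥ 4 (p (p + q) - x) > 0`.
      have hTk : branch p q x s < 2 * p + q := by
        by_contra! h
        unfold negDisc at hN
        nlinarith
      obtain ⟨h3, hr⟩ := (hT.sortedRoots_of_pos_of_neg_sq hp hq hx hs hδ
        (half_sqrt_sq (by linarith))).1 (by unfold midpoint; linarith)
      rw [hr.logRatio_zero_eq (rootProd_pos hp hq hs), add_sideRoot, add_sideRoot, one_mul, one_mul,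
        neg_one_mul, ← sub_eq_add_neg])
    refine ⟨h1, ?_⟩
    rw [h2, hside, hside, abs_of_pos (by linarith), ← hlog]
    ring_nf
  · have hRk : 2 * p + q ≤ R := by
      refine le_of_sq_le_sq ?_ (by positivity)
      nlinarith
    obtain ⟨h1, h2⟩ := integral_logRatio hp hq hx.ne' 0 (-1) hgam (by
      intro s hs hN
      have hT := branch_spec hp hq hx.ne' hs.le
      have hsq := half_sqrt_sq (neg_nonneg.2 hN.le)
      have hδ : 0 < √(-negDisc p q x (branch p q x s)) / 2 := by
        have := neg_pos.2 hN
        positivity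
      have hTk : 2 * p + q < branch p q x s := by
        rw [lt_branch_iff hp hq hx.ne' hs.le (fun _ => by linarith) (fun h => absurd h (by linarith))]
        unfold realCubic
        nlinarith [mul_pos hx hs, mul_nonneg (sub_nonneg.2 hxm) (by positivity : 0 ≤ 2 * p + q)]
      have hm : midpoint p q s (branch p q x s) ≤ 0 := by
        have hc := sideRoot_spec hp hq (e := 1) hx.ne' hs.le (by norm_num) hN.le
        have hT0 := hT.1
        set T := branch p q x s with hTdef
        -- The side zeros `t` have product `x s / T > 0` and negative sum, so both are negative; the
        -- cubic equation then makes `s + t` negative too.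
        have hneg : sideRoot p q x 1 s < 0 := by
          have hπ : 0 < T * (((2 * p + q - T) / 2) ^ 2 - (√(-negDisc p q x T) / 2) ^ 2) := by
            have : T * (((2 * p + q - T) / 2) ^ 2 - (√(-negDisc p q x T) / 2) ^ 2) = x * s := by
              rw [hsq]
              unfold realCubic at hT0
              unfold negDisc
              linear_combination hT0
            rw [this]; positivity
          have hπ' := pos_of_mul_pos_right hπ (by linarith)
          have : √(-negDisc p q x T) / 2 < -((2 * p + q - T) / 2) :=
            lt_of_pow_lt_pow_left₀ 2 (by linarith) (by linarith [neg_sq ((2 * p + q - T) / 2)])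
          rw [sideRoot]
          linarith
        have : x * (s + sideRoot p q x 1 s) < 0 := by
          unfold realCubic at hc
          have h1 : sideRoot p q x 1 s * (sideRoot p q x 1 s - p) * (sideRoot p q x 1 s - p - q) < 0 :=
            mul_neg_of_pos_of_neg (mul_pos_of_neg_of_neg hneg (by linarith)) (by linarith)
          linarith
        have := neg_of_mul_neg_right this hx.le
        rw [add_sideRoot, ← hTdef] at this
        linarith
      obtain ⟨h3, hr⟩ := (hT.sortedRoots_of_pos_of_neg_sq hp hq hx hs hδ hsq).2 hm
      rw [hr.logRatio_zero_eq (rootProd_pos hp hq hs), add_sideRoot, add_sideRoot, one_mul,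
        neg_one_mul, neg_one_mul, ← sub_eq_add_neg]
      ring)
    refine ⟨h1, ?_⟩
    rw [h2, hside, hside, abs_of_nonpos (by linarith), ← hlog]
    ring_nf

theorem extField_one (hx : x < 0) :
    IntegrableOn (logRatio p q 1 x) (Ioi 0) ∧
      extField p q 1 x = logPrimitive p q x ((2 * p + q - √(q ^ 2 + 4 * x)) / 2) -
        logPrimitive p q x ((2 * p + q - -√(q ^ 2 + 4 * x)) / 2) := by
  have hside : ∀ e, sideRoot p q x e 0 = (2 * p + q - -(e * √(q ^ 2 + 4 * x))) / 2 := by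
    intro e
    rw [sideRoot, negDisc_branch_zero_of_neg hp hq hx, neg_neg, branch_zero_of_neg hp hq hx]
    ring
  obtain ⟨h1, h2⟩ := integral_logRatio hp hq hx.ne 1 1
    (fun s hs h => logRatio_eq_zero hp hq hs ((mem_Gam_one_iff hp hq hs).2 ⟨hx, h⟩)) (by
      intro s hs hN
      have hT := branch_spec hp hq hx.ne hs.le
      have hδ : 0 < √(-negDisc p q x (branch p q x s)) / 2 := by
        have := neg_pos.2 hN
        positivity
      obtain ⟨h3, hr⟩ := hT.sortedRoots_of_neg_of_neg_sq hp hq hx hs hδ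
        (half_sqrt_sq (by linarith))
      rw [hr.logRatio_one_eq (rootProd_pos hp hq hs), add_sideRoot, add_sideRoot, one_mul, one_mul,
        neg_one_mul, ← sub_eq_add_neg])
  refine ⟨h1, ?_⟩
  rw [h2, hside, hside]
  simp only [one_mul, neg_mul, neg_neg]

theorem extField_one_of_lt (hx : x < -q ^ 2 / 4) : extField p q 1 x = 0 := by
  have hx0 : x < 0 := hx.trans_le (by have := sq_nonneg q; linarith)
  rw [(extField_one hp hq hx0).2, Real.sqrt_eq_zero_of_nonpos (by linarith)]
  simp

theorem extField_one_of_le (hx : -q ^ 2 / 4 ≤ x) (hx0 : x < 0) : extField p q 1 x =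
    -2 * √(q ^ 2 + 4 * x)
      + q * Real.log ((q + √(q ^ 2 + 4 * x)) / (q - √(q ^ 2 + 4 * x))) := by
  have hR : √(q ^ 2 + 4 * x) ^ 2 = q ^ 2 + 4 * x := Real.sq_sqrt (by linarith)
  have hqR : √(q ^ 2 + 4 * x) < q := (Real.sqrt_lt' hq).2 (by linarith)
  have hR0 := Real.sqrt_nonneg (q ^ 2 + 4 * x)
  rw [(extField_one hp hq hx0).2, logPrimitive_of_sq hx0.ne hR,
    logPrimitive_of_sq hx0.ne (by rw [neg_sq, hR])]
  simp only [sub_neg_eq_add, ← sub_eq_add_neg]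
  rw [Real.log_div (by linarith) (by linarith), Real.log_div (by linarith) (by linarith),
    Real.log_div (by linarith) (by linarith)]
  ring

end ExternalField

/-! ### Densities of `ν_j^ξ`. -/

/-- The half line that contains `Γ_j(s)`. -/
def side (j : Fin 2) : Set ℝ := ![Ioi 0, Iio 0] j

/-- The absolute value of the imaginary parts of the zeros of `uCubic`. -/
def imPart (p q x s : ℝ) : ℝ := √(negDisc p q x (branch p q x s)) / 2

/-- The density of `ν_j^ξ`. -/
def nuDensity (p q ξ : ℝ) (j : Fin 2) : ℝ → ℝ :=
  (side j).indicator fun x => (imPart p q x ξ - imPart p q x 0) / (ξ * (Real.pi * |x|))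

theorem isOpen_side (j : Fin 2) : IsOpen (side j) := by
  fin_cases j
  · exact isOpen_Ioi
  · exact isOpen_Iio

theorem ne_zero_of_mem_side {j : Fin 2} {x : ℝ} (hx : x ∈ side j) : x ≠ 0 := by
  fin_cases j
  · exact ne_of_gt hx
  · exact ne_of_lt hx

section Densities

variable {p q : ℝ} (hp : 0 < p) (hq : 0 < q) {x s ξ : ℝ}

theorem imPart_of_nonpos (h : negDisc p q x (branch p q x s) ≤ 0) : imPart p q x s = 0 := by
  rw [imPart, Real.sqrt_eq_zero_of_nonpos h, zero_div]

/-- The square root in the denominator is `0` here and division by zero gives `0`. -/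
theorem branchDensity_of_nonpos (h : negDisc p q x (branch p q x s) ≤ 0) :
    branchDensity p q x s = 0 := by
  rw [branchDensity, Real.sqrt_eq_zero_of_nonpos h]
  simp

include hp hq

theorem mem_Gam_iff_mem_side (hs : 0 < s) (j : Fin 2) :
    (x : ℂ) ∈ Gam p q s j ↔ x ∈ side j ∧ 0 ≤ negDisc p q x (branch p q x s) := by
  fin_cases j
  · exact mem_Gam_zero_iff hp hq hs
  · exact mem_Gam_one_iff hp hq hs

theorem muDensity_of_mem_side (hs : 0 < s) {j : Fin 2} (hx : x ∈ side j)
    (hN : 0 < negDisc p q x (branch p q x s)) :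
    muDensity p q s j x = (branchDensity p q x s : ℂ) := by
  fin_cases j
  · exact (boundary_zero_of_pos hp hq hx hs hN).2.2.2
  · exact (boundary_one_of_pos hp hq hx hs hN).2.2.2

theorem branchDensity_nonneg (hx : x ≠ 0) (hs : 0 ≤ s) : 0 ≤ branchDensity p q x s := by
  have := cubicDeriv_pos hp hq hx hs (branch_spec hp hq hx hs)
  have := Real.pi_pos
  unfold branchDensity
  positivity

theorem imPart_mono (hx : x ≠ 0) (hs : 0 ≤ s) (h : s ≤ ξ) : imPart p q x s ≤ imPart p q x ξ := by
  unfold imPart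
  have := (negDisc_branch_strictMonoOn hp hq hx).monotoneOn (mem_Ici.2 hs) (mem_Ici.2 (hs.trans h)) h
  gcongr

theorem continuousOn_imPart_right (hx : x ≠ 0) : ContinuousOn (imPart p q x) (Ici 0) := by
  have h := continuousOn_negDisc_branch hp hq hx
  unfold imPart
  fun_prop

theorem continuousOn_negDisc_branch_left (hs : 0 ≤ s) :
    ContinuousOn (fun x => negDisc p q x (branch p q x s)) {x | x ≠ 0} := by
  have h := continuousOn_branch_left hp hq hs
  unfold negDisc
  fun_prop

theorem continuousOn_imPart_left (hs : 0 ≤ s) :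
    ContinuousOn (fun x => imPart p q x s) {x | x ≠ 0} := by
  have h := continuousOn_negDisc_branch_left hp hq hs
  unfold imPart
  fun_prop

/-- The identity that makes the average over `s` explicit. The absolute values match because `x` and
`3T - (2p + q)` have the same sign. -/
theorem hasDerivAt_imPart (hx : x ≠ 0) (hs : 0 < s)
    (hN : 0 < negDisc p q x (branch p q x s)) :
    HasDerivAt (imPart p q x) (Real.pi * |x| * branchDensity p q x s) s := by
  have hT := branch_spec hp hq hx hs.le
  have hE := cubicDeriv_pos hp hq hx hs.le hT
  have hd := hasDerivAt_branch hp hq hx hs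
  have hdN : HasDerivAt (fun s => negDisc p q x (branch p q x s))
      ((6 * branch p q x s - 2 * (2 * p + q)) *
        (x / cubicDeriv p q x (branch p q x s))) s := by
    unfold negDisc
    convert! (((((hd.pow 2).const_mul 3).sub (hd.const_mul (2 * (2 * p + q)))).sub_const
      (q ^ 2)).sub_const (4 * x)) using 1
    norm_num
    ring
  convert! (hdN.sqrt hN.ne').div_const 2 using 1
  have hsq := Real.sqrt_pos.2 hN
  have habs : |x| * |3 * branch p q x s - (2 * p + q)| = x * (3 * branch p q x s - (2 * p + q)) := by
    rw [← abs_mul, abs_of_pos (hT.mul_pos hp hq hx)]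
  have := Real.pi_pos
  unfold branchDensity
  field_simp
  linear_combination 2 * habs

theorem lintegral_branchDensity (hx : x ≠ 0) (hξ : 0 < ξ) :
    ∫⁻ s in Ioc 0 ξ, ENNReal.ofReal (branchDensity p q x s) =
      ENNReal.ofReal ((imPart p q x ξ - imPart p q x 0) / (Real.pi * |x|)) := by
  obtain ⟨s₀, hs₀, hN₀, hlt, hgt, hN0⟩ := exists_threshold hp hq hx
  set a := min s₀ ξ with ha
  have ha0 : 0 ≤ a := le_min hs₀ hξ.le
  have haξ : a ≤ ξ := min_le_right _ _
  have hle : ∀ s, 0 < s → s ≤ a → negDisc p q x (branch p q x s) ≤ 0 := by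
    intro s hs hsa
    have h1 : s ≤ s₀ := hsa.trans (min_le_left _ _)
    rcases h1.eq_or_lt with h | h
    · rw [h, hN0 (h ▸ hs)]
    · exact (hlt s hs.le h).le
  -- Either `a = 0`, or the zeros are all real at both parameters.
  have hend : imPart p q x a = imPart p q x 0 := by
    rcases ha0.eq_or_lt with h | h
    · rw [← h]
    · rw [imPart_of_nonpos (hle a h le_rfl),
        imPart_of_nonpos (hlt 0 le_rfl (h.trans_le (min_le_left _ _))).le]
  have hx' : 0 < |x| := abs_pos.2 hx
  have hπ := Real.pi_pos
  have hIoo : ∀ s ∈ Ioo a ξ, 0 < s ∧ 0 < negDisc p q x (branch p q x s) := by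
    intro s hs
    refine ⟨ha0.trans_lt hs.1, hgt s ?_⟩
    rcases min_lt_iff.1 hs.1 with h | h
    · exact h
    · exact absurd hs.2 (not_lt.2 h.le)
  obtain ⟨i1, i2⟩ := integrableOn_and_setIntegral_of_deriv_nonneg (f := branchDensity p q x)
    (g := fun s => imPart p q x s / (Real.pi * |x|)) haξ
    (((continuousOn_imPart_right hp hq hx).mono fun s hs => ha0.trans hs.1).div_const _)
    (fun s hs => by
      convert! (hasDerivAt_imPart hp hq hx (hIoo s hs).1 (hIoo s hs).2).div_const
        (Real.pi * |x|) using 1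
      field_simp)
    (fun s hs => branchDensity_nonneg hp hq hx (hIoo s hs).1.le)
  rw [← Ioc_union_Ioc_eq_Ioc ha0 haξ, lintegral_union measurableSet_Ioc
    (Ioc_disjoint_Ioc_of_le le_rfl)]
  have h1 : ∫⁻ s in Ioc 0 a, ENNReal.ofReal (branchDensity p q x s) = 0 := by
    rw [setLIntegral_congr_fun (g := fun _ => 0) measurableSet_Ioc fun s hs => by
      simp only
      rw [branchDensity_of_nonpos (hle s hs.1 hs.2), ENNReal.ofReal_zero], lintegral_zero]
  rw [h1, zero_add, ← ofReal_integral_eq_lintegral_ofReal i1, i2, hend, sub_div]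
  rw [EventuallyLE, ae_restrict_iff' measurableSet_Ioc]
  exact ae_of_all _ fun s hs => branchDensity_nonneg hp hq hx (ha0.trans hs.1.le)

theorem measurable_branch : Measurable fun y : ℝ × ℝ => branch p q y.1 y.2 := by
  classical
  have hS : MeasurableSet {y : ℝ × ℝ | y.1 ≠ 0 ∧ 0 ≤ y.2} :=
    (measurableSet_eq_fun measurable_fst measurable_const).compl.inter
      (measurableSet_le measurable_const measurable_snd)
  have h := (continuousOn_branch hp hq).measurable_piecewise
    (continuousOn_const (c := (0 : ℝ)) (s := {y : ℝ × ℝ | y.1 ≠ 0 ∧ 0 ≤ y.2}ᶜ)) hS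
  convert! h using 1
  ext y
  by_cases hy : y.1 ≠ 0 ∧ 0 ≤ y.2
  · rw [Set.piecewise, if_pos (show y ∈ {y : ℝ × ℝ | y.1 ≠ 0 ∧ 0 ≤ y.2} from hy)]
  · rw [Set.piecewise, if_neg (show y ∉ {y : ℝ × ℝ | y.1 ≠ 0 ∧ 0 ≤ y.2} from hy), branch,
      dif_neg fun h => hy ⟨h.1, h.2.1⟩]

theorem measurable_negDisc_branch :
    Measurable fun y : ℝ × ℝ => negDisc p q y.1 (branch p q y.1 y.2) := by
  have := measurable_branch hp hq
  unfold negDisc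
  fun_prop

theorem measurable_negDisc_branch_comp {α : Type*} [MeasurableSpace α] {f g : α → ℝ}
    (hf : Measurable f) (hg : Measurable g) :
    Measurable fun a => negDisc p q (f a) (branch p q (f a) (g a)) := by
  have hb : Measurable fun a => branch p q (f a) (g a) :=
    Measurable.comp (g := fun y : ℝ × ℝ => branch p q y.1 y.2) (measurable_branch hp hq)
      (hf.prodMk hg)
  unfold negDisc
  fun_prop

theorem measurable_branchDensity : Measurable fun y : ℝ × ℝ => branchDensity p q y.1 y.2 := by
  have h1 := measurable_branch hp hq
  have h2 := measurable_negDisc_branch hp hq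
  unfold branchDensity cubicDeriv
  exact ((h1.const_mul 3).sub_const _).abs.div
    ((h2.sqrt.const_mul _).mul (by fun_prop))

theorem measurable_imPart (s : ℝ) : Measurable fun x => imPart p q x s := by
  have h := measurable_negDisc_branch_comp hp hq measurable_id (measurable_const (a := s))
  exact h.sqrt.div_const 2

/-- For fixed `x ≠ 0` strict monotonicity allows at most one exceptional `s`; Fubini exchanges the
quantifiers. The exceptional points are endpoints of `Γ_j(s)`, where `muDensity` has not been
evaluated. -/
theorem ae_negDisc_ne_zero : ∀ᵐ s ∂volume.restrict (Ioc 0 ξ), ∀ᵐ x : ℝ,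
    x ≠ 0 → negDisc p q x (branch p q x s) ≠ 0 := by
  have hm : MeasurableSet {y : ℝ × ℝ | y.2 ≠ 0 → negDisc p q y.2 (branch p q y.2 y.1) ≠ 0} := by
    have h1 : MeasurableSet {y : ℝ × ℝ | y.2 = 0} :=
      measurableSet_eq_fun measurable_snd measurable_const
    have h := measurable_negDisc_branch_comp hp hq (measurable_snd (α := ℝ) (β := ℝ))
      (measurable_fst (α := ℝ) (β := ℝ))
    have h2 : MeasurableSet {y : ℝ × ℝ | negDisc p q y.2 (branch p q y.2 y.1) = 0} :=
      h (measurableSet_singleton 0)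
    convert! h1.union h2.compl using 1
    ext y
    simp only [mem_ofPred_eq, mem_union, mem_compl_iff]
    tauto
  rw [Measure.ae_ae_comm hm]
  refine ae_of_all _ fun x => ?_
  by_cases hx : x = 0
  · exact ae_of_all _ fun s h => absurd hx h
  · rw [ae_restrict_iff' measurableSet_Ioc]
    have hsub : {s : ℝ | 0 ≤ s ∧ negDisc p q x (branch p q x s) = 0}.Subsingleton := by
      intro a ha b hb
      exact (negDisc_branch_strictMonoOn hp hq hx).injOn (mem_Ici.2 ha.1) (mem_Ici.2 hb.1)
        (ha.2.trans hb.2.symm)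
    have h0 := hsub.measure_zero volume
    filter_upwards [measure_eq_zero_iff_ae_notMem.1 h0] with s hs hs' _ h
    exact hs ⟨hs'.1.le, h⟩

omit hp hq in
theorem mu_density_measurable (hm : Measurable fun y : ℝ × ℝ => branchDensity p q y.1 y.2)
    (j : Fin 2) : Measurable fun y : ℝ × ℝ =>
      (side j).indicator (fun x => ENNReal.ofReal (branchDensity p q x y.1)) y.2 := by
  have h : Measurable fun y : ℝ × ℝ => ENNReal.ofReal (branchDensity p q y.2 y.1) :=
    (hm.comp measurable_swap).ennreal_ofReal
  exact h.indicator ((isOpen_side j).measurableSet.preimage measurable_snd)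

theorem mu_eq_withDensity (hs : 0 < s) (j : Fin 2)
    (hae : ∀ᵐ x : ℝ, x ≠ 0 → negDisc p q x (branch p q x s) ≠ 0) :
    mu p q j s = volume.withDensity
      ((side j).indicator fun x => ENNReal.ofReal (branchDensity p q x s)) := by
  have hG : {x : ℝ | (x : ℂ) ∈ Gam p q s j} =
      side j ∩ {x | 0 ≤ negDisc p q x (branch p q x s)} := by
    ext x
    exact mem_Gam_iff_mem_side hp hq hs j
  have hmeas : MeasurableSet {x : ℝ | (x : ℂ) ∈ Gam p q s j} := by
    rw [hG]
    have h := measurable_negDisc_branch_comp hp hq measurable_id (measurable_const (a := s))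
    exact (isOpen_side j).measurableSet.inter (h measurableSet_Ici)
  rw [mu, ← withDensity_indicator hmeas]
  refine withDensity_congr_ae ?_
  filter_upwards [hae] with x hx
  rw [hG]
  by_cases hxs : x ∈ side j
  · rw [indicator_of_mem hxs]
    rcases lt_or_gt_of_ne (hx (ne_zero_of_mem_side hxs)) with h | h
    · rw [indicator_of_notMem fun h' => not_le.2 h h'.2, branchDensity_of_nonpos h.le,
        ENNReal.ofReal_zero]
    · rw [indicator_of_mem (show x ∈ side j ∩ _ from ⟨hxs, h.le⟩), muDensity_of_mem_side hp hq hs hxs h,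
        Complex.ofReal_re]
  · rw [indicator_of_notMem hxs, indicator_of_notMem fun h' => hxs h'.1]

theorem ae_mu_eq_withDensity (j : Fin 2) : ∀ᵐ s ∂volume.restrict (Ioc 0 ξ),
    mu p q j s = volume.withDensity
      ((side j).indicator fun x => ENNReal.ofReal (branchDensity p q x s)) := by
  filter_upwards [ae_negDisc_ne_zero hp hq, ae_restrict_mem measurableSet_Ioc] with s h1 h2
  exact mu_eq_withDensity hp hq h2.1 j h1

theorem aemeasurable_mu (j : Fin 2) : AEMeasurable (mu p q j) (volume.restrict (Ioc 0 ξ)) := by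
  refine ⟨fun s => volume.withDensity
      ((side j).indicator fun x => ENNReal.ofReal (branchDensity p q x s)), ?_,
    ae_mu_eq_withDensity hp hq j⟩
  refine Measure.measurable_of_measurable_coe _ fun A hA => ?_
  simp_rw [withDensity_apply _ hA]
  exact (mu_density_measurable (measurable_branchDensity hp hq) j).lintegral_prod_right'

/-- Tonelli: integrating in `s` first leaves `lintegral_branchDensity` at each `x`. -/
theorem nu_eq_withDensity (hξ : 0 < ξ) (j : Fin 2) :
    nu p q ξ j = volume.withDensity fun x => ENNReal.ofReal (nuDensity p q ξ j x) := by
  have hm := mu_density_measurable (measurable_branchDensity hp hq) j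
  ext A hA
  rw [nu, Measure.smul_apply, Measure.bind_apply hA (aemeasurable_mu hp hq j),
    lintegral_congr_ae ((ae_mu_eq_withDensity hp hq j).mono fun s hs => by rw [hs])]
  simp_rw [withDensity_apply _ hA]
  rw [lintegral_lintegral_swap hm.aemeasurable, smul_eq_mul,
    ← lintegral_const_mul _ hm.lintegral_prod_left']
  refine lintegral_congr fun x => ?_
  by_cases hx : x ∈ side j
  · have hx0 := ne_zero_of_mem_side hx
    simp only [indicator_of_mem hx, nuDensity]
    rw [lintegral_branchDensity hp hq hx0 hξ, ← ENNReal.ofReal_mul (by positivity)]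
    congr 1
    have := Real.pi_pos
    have := abs_pos.2 hx0
    field_simp
  · simp only [indicator_of_notMem hx, nuDensity, lintegral_zero, mul_zero, ENNReal.ofReal_zero]

theorem nuDensity_nonneg (hξ : 0 < ξ) (j : Fin 2) (x : ℝ) : 0 ≤ nuDensity p q ξ j x := by
  refine indicator_nonneg (fun x hx => ?_) x
  have := imPart_mono hp hq (ne_zero_of_mem_side hx) le_rfl hξ.le
  have := Real.pi_pos
  exact div_nonneg (sub_nonneg.2 ‹_›) (by positivity)

theorem measurable_nuDensity (ξ : ℝ) (j : Fin 2) : Measurable (nuDensity p q ξ j) := by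
  refine Measurable.indicator ?_ (isOpen_side j).measurableSet
  have h1 := measurable_imPart hp hq ξ
  have h2 := measurable_imPart hp hq 0
  exact (h1.sub h2).div (by fun_prop)

theorem continuousAt_nuDensity (hξ : 0 < ξ) {j : Fin 2} (hx : x ∈ side j) :
    ContinuousAt (nuDensity p q ξ j) x := by
  have hx0 := ne_zero_of_mem_side hx
  have hnhds : {x : ℝ | x ≠ 0} ∈ 𝓝 x := isOpen_ne.mem_nhds hx0
  have h1 := (continuousOn_imPart_left hp hq hξ.le).continuousAt hnhds
  have h2 := (continuousOn_imPart_left hp hq le_rfl).continuousAt hnhds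
  have h : ContinuousAt (fun x => (imPart p q x ξ - imPart p q x 0) / (ξ * (Real.pi * |x|))) x := by
    refine (h1.sub h2).div (by fun_prop) ?_
    have := abs_pos.2 hx0
    positivity
  refine h.congr ?_
  filter_upwards [(isOpen_side j).mem_nhds hx] with y hy
  rw [nuDensity, indicator_of_mem hy]

/-- Where the density is positive it is so nearby, by continuity, so every neighbourhood has
positive mass. -/
theorem isDensity_nuDensity (hξ : 0 < ξ) (j : Fin 2) :
    IsDensity (nu p q ξ j) (nuDensity p q ξ j) := by
  refine ⟨measurable_nuDensity hp hq ξ j, nuDensity_nonneg hp hq hξ j,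
    nu_eq_withDensity hp hq hξ j, fun x hx => ?_⟩
  by_contra h
  have hxs : x ∈ side j := by
    by_contra h'
    exact h (by rw [nuDensity, indicator_of_notMem h'])
  have hpos : 0 < nuDensity p q ξ j x := (nuDensity_nonneg hp hq hξ j x).lt_of_ne' h
  rw [Measure.notMem_support_iff_exists] at hx
  obtain ⟨U, hU, h0⟩ := hx
  rw [nu_eq_withDensity hp hq hξ j, withDensity_apply_eq_zero
    (measurable_nuDensity hp hq ξ j).ennreal_ofReal] at h0
  have hev := (continuousAt_nuDensity hp hq hξ hxs).eventually (lt_mem_nhds hpos)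
  refine (Measure.measure_pos_of_mem_nhds volume (x := x) ?_).ne' h0
  filter_upwards [hev, hU] with y h1 h2
  exact ⟨(ENNReal.ofReal_pos.2 h1).ne', h2⟩

/-- At `x = 0` the zeros `t` are `0, p, p + q`, real and distinct, and this persists for small `x`.
It keeps `0` out of both supports. -/
theorem eventually_negDisc_neg (hξ : 0 < ξ) :
    ∀ᶠ x in 𝓝 (0 : ℝ), x ≠ 0 → negDisc p q x (branch p q x ξ) < 0 := by
  have hc : ∀ y, Tendsto (fun x => realCubic p q x ξ y) (𝓝 0) (𝓝 (realCubic p q 0 ξ y)) := by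
    intro y
    have : Continuous fun x => realCubic p q x ξ y := by unfold realCubic; fun_prop
    exact this.tendsto 0
  -- At `x = 0`, `negDisc` is `-p²` for `T = p + q` and `-q²` for `T = 0`; moving `T` to `a` or `-b`
  -- uses up at most half of this.
  obtain ⟨a, ha⟩ : ∃ a, a = p + q + p ^ 2 / (10 * p + 8 * q) := ⟨_, rfl⟩
  obtain ⟨b, hb⟩ : ∃ b, b = q ^ 2 / (8 * p + 10 * q) := ⟨_, rfl⟩
  have hb0 : 0 < b := by rw [hb]; positivity
  have hbm : b * (8 * p + 10 * q) = q ^ 2 := by rw [hb]; field_simp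
  have hbq : b ≤ q := by nlinarith
  have ha0 : 0 < a - (p + q) := by rw [ha, add_sub_cancel_left]; positivity
  have ham : (a - (p + q)) * (10 * p + 8 * q) = p ^ 2 := by
    rw [ha, add_sub_cancel_left]; field_simp
  have hap : a - (p + q) ≤ p := by nlinarith
  have h1 : 0 < realCubic p q 0 ξ a := by
    unfold realCubic
    rw [zero_mul, sub_zero]
    exact mul_pos (mul_pos (by linarith) (by linarith)) (by linarith)
  have h2 : realCubic p q 0 ξ (-b) < 0 := by
    unfold realCubic
    rw [zero_mul, sub_zero]
    exact mul_neg_of_pos_of_neg (mul_pos_of_neg_of_neg (by linarith) (by linarith)) (by linarith)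
  have h3 : ∀ᶠ x in 𝓝 (0 : ℝ), -q ^ 2 / 8 < x :=
    lt_mem_nhds (by have := pow_pos hq 2; linarith)
  filter_upwards [(hc a).eventually (lt_mem_nhds h1), (hc (-b)).eventually (gt_mem_nhds h2), h3]
    with x e1 e2 e3 hx
  have hT := branch_spec hp hq hx hξ.le
  rcases lt_or_gt_of_ne hx with hx' | hx'
  · have h4 := (lt_branch_iff hp hq hx hξ.le (fun h => absurd h (by linarith))
      (fun _ => by linarith)).2 e2
    have h5 := hT.2.2 hx'
    unfold negDisc
    nlinarith
  · have h4 := (branch_lt_iff hp hq hx hξ.le (fun _ => by linarith)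
      (fun h => absurd h (by linarith))).2 e1
    have h5 := hT.2.1 hx'
    unfold negDisc
    nlinarith

theorem nuDensity_eq_zero (hξ : 0 < ξ) {j : Fin 2}
    (h : x ≠ 0 → negDisc p q x (branch p q x ξ) ≤ 0) : nuDensity p q ξ j x = 0 := by
  by_cases hx : x ∈ side j
  · have hx0 := ne_zero_of_mem_side hx
    have h0 := imPart_mono hp hq hx0 le_rfl hξ.le
    rw [imPart_of_nonpos (h hx0)] at h0
    have h1 : 0 ≤ imPart p q x 0 := by unfold imPart; positivity
    rw [nuDensity, indicator_of_mem hx, imPart_of_nonpos (h hx0), le_antisymm h0 h1, sub_zero,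
      zero_div]
  · rw [nuDensity, indicator_of_notMem hx]

/-- Otherwise the density vanishes near `x`: by `eventually_negDisc_neg` at `0`, and elsewhere
because the failing condition fails on a neighbourhood. -/
theorem mem_side_of_mem_support (hξ : 0 < ξ) {j : Fin 2} (hx : x ∈ (nu p q ξ j).support) :
    x ∈ side j ∧ 0 ≤ negDisc p q x (branch p q x ξ) := by
  by_contra hcon
  have hev : ∀ᶠ y in 𝓝 x, nuDensity p q ξ j y = 0 := by
    by_cases hx0 : x = 0
    · subst hx0
      filter_upwards [eventually_negDisc_neg hp hq hξ] with y hy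
      exact nuDensity_eq_zero hp hq hξ fun h => (hy h).le
    · by_cases hN : 0 ≤ negDisc p q x (branch p q x ξ)
      · have hxs : x ∉ side j := fun h => hcon ⟨h, hN⟩
        have hcl : (side j)ᶜ ∈ 𝓝 x := by
          fin_cases j
          · filter_upwards [gt_mem_nhds ((not_lt.1 hxs).lt_of_ne hx0)] with y hy
            exact not_lt.2 (le_of_lt hy)
          · filter_upwards [lt_mem_nhds ((not_lt.1 hxs).lt_of_ne' hx0)] with y hy
            exact not_lt.2 (le_of_lt hy)
        filter_upwards [hcl] with y hy
        rw [nuDensity, indicator_of_notMem hy]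
      · push Not at hN
        have hc := (continuousOn_negDisc_branch_left hp hq hξ.le).continuousAt
          (isOpen_ne.mem_nhds hx0)
        filter_upwards [hc.eventually (gt_mem_nhds hN)] with y hy
        exact nuDensity_eq_zero hp hq hξ fun _ => le_of_lt hy
  rw [Measure.mem_support_iff_forall] at hx
  refine (hx _ hev).ne' ?_
  rw [nu_eq_withDensity hp hq hξ j, withDensity_apply_eq_zero
    (measurable_nuDensity hp hq ξ j).ennreal_ofReal]
  convert! measure_empty (μ := (volume : Measure ℝ))
  ext y
  simp only [mem_inter_iff, mem_ofPred_eq, mem_empty_iff_false, iff_false, not_and]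
  intro h1 h2
  rw [h2] at h1
  simp at h1

theorem pair_ne_zero (hx : x ≠ 0) (hs : 0 < s) (hN : 0 ≤ negDisc p q x (branch p q x s)) :
    (midpoint p q s (branch p q x s) : ℂ) + (imPart p q x s : ℂ) * Complex.I ≠ 0 ∧
      (midpoint p q s (branch p q x s) : ℂ) - (imPart p q x s : ℂ) * Complex.I ≠ 0 := by
  have hP := rootProd_pos hp hq hs
  rw [← mul_midpoint_sq (branch_spec hp hq hx hs.le).1, ← half_sqrt_sq hN,
    ← normSq_add_mul_I] at hP
  have h : ‖(midpoint p q s (branch p q x s) : ℂ) + (imPart p q x s : ℂ) * Complex.I‖ ≠ 0 := by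
    intro h
    unfold imPart at h
    rw [h] at hP
    simp at hP
  exact ⟨norm_ne_zero_iff.1 h, norm_ne_zero_iff.1 (by rwa [norm_sub_eq_norm_add])⟩

omit hp hq in
-- `(z₊ - z₋) / (z₊ z₋) = 1 / z₋ - 1 / z₊ = (U - V) / rootProd`, and `rootProd` cancels against the
-- constant.
theorem constC_mul_jumpQuot {j : Fin 3} {U V : ℂ} (hP : 0 < rootProd p q ξ) (hU : U ≠ 0)
    (hV : V ≠ 0) (h1 : solPlus p q ξ j x = -(rootProd p q ξ : ℂ) / U)
    (h2 : solMinus p q ξ j x = -(rootProd p q ξ : ℂ) / V) {y : ℝ}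
    (hUV : U - V = ((2 * y : ℝ) : ℂ) * Complex.I) :
    constC p q ξ * jumpQuot p q ξ j x = ((y / (Real.pi * x) : ℝ) : ℂ) := by
  have hR : (rootProd p q ξ : ℂ) ≠ 0 := by exact_mod_cast hP.ne'
  have hI := Complex.I_ne_zero
  have hπ : (Real.pi : ℂ) ≠ 0 := by exact_mod_cast Real.pi_ne_zero
  have e : jumpQuot p q ξ j x = (U - V) / (rootProd p q ξ * x) := by
    rw [jumpQuot, h1, h2]
    by_cases hx : (x : ℂ) = 0
    · rw [hx]; simp
    · field_simp
      ring
  have e2 : constC p q ξ = rootProd p q ξ / (2 * Real.pi * Complex.I) := rfl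
  rw [e, e2, hUV]
  push_cast
  by_cases hx : (x : ℂ) = 0
  · rw [hx]; simp
  · field_simp

theorem nuDensity_zero_spec (hξ : 0 < ξ) (hx : x ∈ (nu p q ξ 0).support) :
    x ≠ 0 ∧ HasBoundaryValues p q ξ 0 x ∧
      (nuDensity p q ξ 0 x : ℂ) = 1 / (ξ : ℂ) * (constC p q ξ * jumpQuot p q ξ 0 x) := by
  obtain ⟨hxs, hN⟩ := mem_side_of_mem_support hp hq hξ hx
  have hx0 : 0 < x := hxs
  obtain ⟨h1, h2, h3⟩ := boundary_zero hp hq hx0 hξ hN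
  obtain ⟨hU, hV⟩ := pair_ne_zero hp hq hx0.ne' hξ hN
  refine ⟨hx0.ne', h1, ?_⟩
  rw [constC_mul_jumpQuot (rootProd_pos hp hq hξ) hU hV h2 h3 (y := imPart p q x ξ)
    (by push_cast; ring), nuDensity, indicator_of_mem hxs,
    imPart_of_nonpos (s := 0) (by
      rw [negDisc_branch_zero_of_pos hp hq hx0]; exact neg_nonpos.2 (sq_nonneg _)),
    abs_of_pos hx0]
  push_cast
  rw [sub_zero, ← div_div, div_div, div_mul_eq_div_div_swap]
  ring

theorem nuDensity_one_spec (hξ : 0 < ξ) (hx : x ∈ (nu p q ξ 1).support) :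
    x < 0 ∧ HasBoundaryValues p q ξ 1 x ∧
      (-q ^ 2 / 4 < x →
        (nuDensity p q ξ 1 x : ℂ) = 1 / (ξ : ℂ) * (constC p q ξ * jumpQuot p q ξ 1 x)) ∧
      (x ≤ -q ^ 2 / 4 →
        (nuDensity p q ξ 1 x : ℂ) = 1 / (ξ : ℂ) * (constC p q ξ * jumpQuot p q ξ 1 x
          + ((√|q ^ 2 + 4 * x| / (2 * Real.pi * x) : ℝ) : ℂ))) := by
  obtain ⟨hxs, hN⟩ := mem_side_of_mem_support hp hq hξ hx
  have hx0 : x < 0 := hxs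
  obtain ⟨h1, h2, h3⟩ := boundary_one hp hq hx0 hξ hN
  obtain ⟨hU, hV⟩ := pair_ne_zero hp hq hx0.ne hξ hN
  have hπ := Real.pi_pos
  -- The `+` value comes from the zero with negative imaginary part; the sign is absorbed by `|x| =
  -- -x`.
  have hj := constC_mul_jumpQuot (rootProd_pos hp hq hξ) hV hU h2 h3 (y := -imPart p q x ξ)
    (by push_cast; ring)
  refine ⟨hx0, h1, fun h => ?_, fun h => ?_⟩
  · rw [hj, nuDensity, indicator_of_mem hxs, imPart_of_nonpos (s := 0) (by
      rw [negDisc_branch_zero_of_neg hp hq hx0]; linarith), abs_of_neg hx0, sub_zero]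
    have : imPart p q x ξ / (ξ * (Real.pi * -x)) = 1 / ξ * (-imPart p q x ξ / (Real.pi * x)) := by
      have := hx0.ne
      field_simp
    rw [this]
    push_cast
    ring
  · have h0 : imPart p q x 0 = √|q ^ 2 + 4 * x| / 2 := by
      rw [imPart, negDisc_branch_zero_of_neg hp hq hx0, abs_of_nonpos (by linarith)]
    rw [hj, nuDensity, indicator_of_mem hxs, h0, abs_of_neg hx0]
    have : (imPart p q x ξ - √|q ^ 2 + 4 * x| / 2) / (ξ * (Real.pi * -x)) =
        1 / ξ * (-imPart p q x ξ / (Real.pi * x) + √|q ^ 2 + 4 * x| / (2 * Real.pi * x)) := by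
      have := hx0.ne
      field_simp
      ring
    rw [this]
    push_cast
    ring

end Densities

end Macdonald

end

theorem theorem2p5 (p q : ℝ) (hp : 0 < p) (hq : 0 < q) :
    (∀ x : ℝ, 0 < x →
      IntegrableOn (Macdonald.logRatio p q 0 x) (Ioi 0) ∧
      Macdonald.extField p q 0 x =
        √(q ^ 2 + 4 * x) - p * Real.log (4 * x) - q * Real.log (√(q ^ 2 + 4 * x) + q)
          - 2 * p - q + p * Real.log (4 * p ^ 2 + 4 * p * q) + q * Real.log (2 * p + 2 * q)) ∧
    (∀ x : ℝ, x < 0 → IntegrableOn (Macdonald.logRatio p q 1 x) (Ioi 0)) ∧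
    (∀ x : ℝ, x < -q ^ 2 / 4 → Macdonald.extField p q 1 x = 0) ∧
    (∀ x : ℝ, -q ^ 2 / 4 ≤ x → x < 0 →
      Macdonald.extField p q 1 x =
        -2 * √(q ^ 2 + 4 * x)
          + q * Real.log ((q + √(q ^ 2 + 4 * x)) / (q - √(q ^ 2 + 4 * x)))) ∧
    ∀ ξ : ℝ, 0 < ξ →
      AEMeasurable (Macdonald.mu p q 0) (volume.restrict (Ioc 0 ξ)) ∧
      (∃ f : ℝ → ℝ, Macdonald.IsDensity (Macdonald.nu p q ξ 0) f ∧
        ∀ x ∈ (Macdonald.nu p q ξ 0).support,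
          x ≠ 0 ∧ Macdonald.HasBoundaryValues p q ξ 0 x ∧
          (f x : ℂ) = 1 / (ξ : ℂ) * (Macdonald.constC p q ξ * Macdonald.jumpQuot p q ξ 0 x)) ∧
      AEMeasurable (Macdonald.mu p q 1) (volume.restrict (Ioc 0 ξ)) ∧
      (∃ f : ℝ → ℝ, Macdonald.IsDensity (Macdonald.nu p q ξ 1) f ∧
        ∀ x ∈ (Macdonald.nu p q ξ 1).support,
          x < 0 ∧ Macdonald.HasBoundaryValues p q ξ 1 x ∧
          (-q ^ 2 / 4 < x →
            (f x : ℂ) = 1 / (ξ : ℂ) * (Macdonald.constC p q ξ * Macdonald.jumpQuot p q ξ 1 x)) ∧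
          (x ≤ -q ^ 2 / 4 →
            (f x : ℂ) = 1 / (ξ : ℂ) * (Macdonald.constC p q ξ * Macdonald.jumpQuot p q ξ 1 x
              + ((√|q ^ 2 + 4 * x| / (2 * Real.pi * x) : ℝ) : ℂ)))) :=
  ⟨fun _ hx => Macdonald.extField_zero hp hq hx, fun _ hx => (Macdonald.extField_one hp hq hx).1,
    fun _ hx => Macdonald.extField_one_of_lt hp hq hx,
    fun _ hx hx0 => Macdonald.extField_one_of_le hp hq hx hx0,
    fun _ hξ => ⟨Macdonald.aemeasurable_mu hp hq 0,
      ⟨_, Macdonald.isDensity_nuDensity hp hq hξ 0,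
        fun _ hx => Macdonald.nuDensity_zero_spec hp hq hξ hx⟩,
      Macdonald.aemeasurable_mu hp hq 1,
      ⟨_, Macdonald.isDensity_nuDensity hp hq hξ 1,
        fun _ hx => Macdonald.nuDensity_one_spec hp hq hξ hx⟩⟩⟩
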